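/- Let $T$ be a compact metric space, and let $\mathbb C^+$ be the set of nonnegative continuous functions on $T$ with the uniform norm $\|x\|=\sup_{t\in T}|x(t)|$. For each $n\ge 1$ let $X_{1n},X_{2n},\ldots$ be independent copies of a random element $X_n$ of $\mathbb C^+$. Let $\mathbb S=\{x\in\mathbb C^+:\|x\|=1\}$ and $\overline{\mathbb C}{}_0^+=(0,\infty]\times\mathbb S$ with the metric $$d((r_1,s_1),(r_2,s_2))=|1/r_1-1/r_2|+\|s_1-s_2\| ,$$ and identify $\mathbb C_0^+=\mathbb C^+\setminus\{0\}$ with $(0,\infty)\times\mathbb S\subset\overline{\mathbb C}{}_0^+$ through $x\mapsto(\|x\|,x/\|x\|)$. Let $\nu$ be a Borel measure on $\overline{\mathbb C}{}_0^+$ that is finite on bounded sets, with $\nu(\overline{\mathbb C}{}_0^+\setminus\mathbb C_0^+)=0$, and assume that $$n\,\mathbb P[X_n\in\cdot\,]\to\nu\quad\sharp\text{-weakly on }\overline{\mathbb C}{}_0^+ ,$$ that is, $\int f\,d(n\,\mathbb P[X_n\in\cdot\,\cap\,\mathbb C_0^+])\to\int f\,d\nu$ for every bounded continuous $f:\overline{\mathbb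 C}{}_0^+\to\mathbb R$ with bounded support. For $j\ge 1$, $u\ge 0$ and $t\in T$ let $\tilde M_n^j(u,t)$ be the $j$-th largest value among $X_{1n}(t),\ldots,X_{[nu]n}(t)$, and $\tilde M_n^j(u,t)=0$ if $j>[nu]$. Let $\tilde\Pi_\nu$ be a Poisson point process on $\mathbb C_0^+\times[0,\infty)$ with intensity $\nu\otimes\ell$, where $\ell$ is the Lebesgue measure on $[0,\infty)$, and let $$\tilde M^j(u,t)=\sup\{y\ge 0:\ \tilde\Pi_\nu(B_{u,t}^y)\ge j\},\qquad B_{u,t}^y=\{(f,v)\in\mathbb C_0^+\times[0,\infty):\ f(t)\ge y,\ v\le u\},$$ with $\sup\emptyset=0$. Then, for every $r\ge 1$, $(\tilde M_n^1,\ldots,\tilde M_n^r)$ and $(\tilde M^1,\ldots,\tilde M^r)$ are random elements of the Skorokhod space $\mathbb D([0,\infty),(\mathbb C^+)^r)$ with the $J_1$-topology, and $(\tilde M_n^1,\ldots,\tilde M_n^r)$ converges weakly to $(\tilde M^1,\ldots,\tilde M^r)$ in $\mathbb D([0,\infty),(\mathbb C^+)^r)$ as $n\to\infty$. -/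

import Mathlib

open MeasureTheory ProbabilityTheory Filter Topology
open scoped NNReal ENNReal BoundedContinuousFunction

noncomputable section

/-! ### The space of nonnegative continuous functions and its compactification at infinity -/

/-- `C⁺(T)`: nonnegative continuous functions on the compact metric space `T`, with the uniform
metric. -/
abbrev CPlus (T : Type*) [TopologicalSpace T] : Type _ := C(T, ℝ≥0)

/-- The Borel σ-algebra of the uniform metric on `C⁺(T)`. -/
instance CPlus.instMeasurableSpace {T : Type*} [TopologicalSpace T] :
    MeasurableSpace C(T, ℝ≥0) := borel _

instance CPlus.instBorelSpace {T : Type*} [TopologicalSpace T] : BorelSpace C(T, ℝ≥0) := ⟨rfl⟩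

/-- The uniform norm `‖x‖ = sup_t x(t)` of `x ∈ C⁺(T)`. -/
def CPlus.supNorm {T : Type*} [TopologicalSpace T] (x : CPlus T) : ℝ≥0 := ⨆ t, x t

/-- The space `(0, ∞] × S`, where `S` is the unit sphere of `C⁺(T)`. -/
@[ext]
structure PolarSpace (T : Type*) [TopologicalSpace T] where
  radius : ℝ≥0∞
  radius_pos : 0 < radius
  angle : CPlus T
  supNorm_angle : angle.supNorm = 1

namespace PolarSpace

variable {T : Type*} [TopologicalSpace T] [CompactSpace T]

/-- The metric `d((r₁,s₁),(r₂,s₂)) = |1/r₁ - 1/r₂| + ‖s₁ - s₂‖`, with `1/∞ = 0`. -/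
instance instMetricSpace : MetricSpace (PolarSpace T) where
  dist p q := |(p.radius⁻¹).toReal - (q.radius⁻¹).toReal| + dist p.angle q.angle
  dist_self p := by simp
  dist_comm p q := by rw [abs_sub_comm, dist_comm]
  dist_triangle p q r := by
    have h₁ := abs_sub_le (p.radius⁻¹).toReal (q.radius⁻¹).toReal (r.radius⁻¹).toReal
    have h₂ := dist_triangle p.angle q.angle r.angle
    linarith
  eq_of_dist_eq_zero := by
    intro p q h
    have h₁ := abs_nonneg ((p.radius⁻¹).toReal - (q.radius⁻¹).toReal)
    have h₂ := dist_nonneg (x := p.angle) (y := q.angle)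
    have h₃ : |(p.radius⁻¹).toReal - (q.radius⁻¹).toReal| = 0 := by linarith
    have h₄ : dist p.angle q.angle = 0 := by linarith
    have h₅ : (p.radius⁻¹).toReal = (q.radius⁻¹).toReal := by
      rw [abs_eq_zero] at h₃
      linarith
    rw [ENNReal.toReal_eq_toReal_iff' (ENNReal.inv_ne_top.2 p.radius_pos.ne')
      (ENNReal.inv_ne_top.2 q.radius_pos.ne'), inv_inj] at h₅
    exact PolarSpace.ext h₅ (dist_eq_zero.1 h₄)

instance instMeasurableSpace : MeasurableSpace (PolarSpace T) := borel _

instance instBorelSpace : BorelSpace (PolarSpace T) := ⟨rfl⟩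

end PolarSpace

theorem CPlus.bddAbove_range {T : Type*} [TopologicalSpace T] [CompactSpace T] (x : CPlus T) :
    BddAbove (Set.range x) :=
  (isCompact_range x.continuous).bddAbove

theorem CPlus.supNorm_ne_zero {T : Type*} [TopologicalSpace T] [CompactSpace T] {x : CPlus T}
    (hx : x ≠ 0) : x.supNorm ≠ 0 := by
  intro h
  refine hx (ContinuousMap.ext fun t => ?_)
  have h₁ : x t ≤ x.supNorm := le_ciSup x.bddAbove_range t
  rw [h] at h₁
  simpa using h₁

/-- The polar decomposition `x ↦ (‖x‖, x / ‖x‖)` on `C₀⁺ = C⁺ \ {0}`. -/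
def polar {T : Type*} [TopologicalSpace T] [CompactSpace T] (x : {x : CPlus T // x ≠ 0}) :
    PolarSpace T where
  radius := (x.1.supNorm : ℝ≥0∞)
  radius_pos := by
    have := CPlus.supNorm_ne_zero x.2
    exact_mod_cast pos_iff_ne_zero.2 this
  angle := ⟨fun t => x.1 t / x.1.supNorm, x.1.continuous.div_const _⟩
  supNorm_angle := by
    have h := CPlus.supNorm_ne_zero x.2
    have h₁ : (⨆ t, x.1 t / x.1.supNorm) = (⨆ t, x.1 t) / x.1.supNorm :=
      (NNReal.iSup_div _ _).symm
    exact h₁.trans (div_self h)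

/-- A measure on `C⁺`, restricted to `C₀⁺ = C⁺ \ {0}` and carried over to `(0, ∞] × S` by the
polar decomposition. -/
def polarMeasure {T : Type*} [TopologicalSpace T] [CompactSpace T] (μ : Measure (CPlus T)) :
    Measure (PolarSpace T) :=
  (μ.comap (Subtype.val : {x : CPlus T // x ≠ 0} → CPlus T)).map polar

/-! ### Boundedly finite measures and point processes -/

/-- A measure is boundedly finite if bounded measurable sets have finite measure. -/
def IsBoundedlyFinite {E : Type*} [PseudoMetricSpace E] [MeasurableSpace E] (μ : Measure E) :
    Prop :=
  ∀ B : Set E, Bornology.IsBounded B → MeasurableSet B → μ B < ∞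

/-- `♯`-weak convergence: convergence of the integrals of all bounded continuous functions with
bounded support. -/
def TendstoSharpWeakly {E : Type*} [PseudoMetricSpace E] [MeasurableSpace E]
    (μs : ℕ → Measure E) (μ : Measure E) : Prop :=
  ∀ f : E →ᵇ ℝ, Bornology.IsBounded (Function.support f) →
    Tendsto (fun n => ∫ x, f x ∂(μs n)) atTop (𝓝 (∫ x, f x ∂μ))

/-- A boundedly finite point measure: `μ = ∑_{i ∈ I} δ_{x i}` for an at most countable family of
points, of which every bounded set contains only finitely many. -/
def IsBoundedlyFinitePointMeasure {E : Type*} [PseudoMetricSpace E] [MeasurableSpace E]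
    (μ : Measure E) : Prop :=
  ∃ (I : Set ℕ) (x : I → E), (∀ B : Set E, Bornology.IsBounded B → {i | x i ∈ B}.Finite) ∧
    μ = Measure.sum fun i => Measure.dirac (x i)

/-- `N` is a (boundedly finite) Poisson point process on `E` with intensity `ν`, defined on the
probability space `(Ω, P)`. -/
structure IsPoissonPointProcess {Ω E : Type*} [MeasurableSpace Ω] [PseudoMetricSpace E]
    [MeasurableSpace E] (N : Ω → Measure E) (ν : Measure E) (P : Measure Ω) : Prop where
  measurable : Measurable N
  pointMeasure : ∀ ω, IsBoundedlyFinitePointMeasure (N ω)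
  law : ∀ A : Set E, MeasurableSet A → ν A ≠ ∞ →
    P.map (fun ω => N ω A) = (poissonMeasure (ν A).toNNReal).map (Nat.cast : ℕ → ℝ≥0∞)
  indep : ∀ (k : ℕ) (A : Fin k → Set E), (∀ i, MeasurableSet (A i)) →
    Pairwise (Function.onFun Disjoint A) → iIndepFun (fun i ω => N ω (A i)) P

/-- Lebesgue measure on `[0, ∞)`. -/
def lebesgueHalfLine : Measure ℝ≥0 := (volume : Measure ℝ).comap ((↑) : ℝ≥0 → ℝ)

/-! ### The Skorokhod space `D([0, ∞), E)` -/

/-- Càdlàg functions `[0, ∞) → E`. -/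
@[ext]
structure SkorokhodSpace (E : Type*) [TopologicalSpace E] where
  toFun : ℝ≥0 → E
  right_continuous : ∀ u, ContinuousWithinAt toFun (Set.Ici u) u
  left_limits : ∀ u, ∃ l, Tendsto toFun (𝓝[<] u) (𝓝 l)

namespace SkorokhodSpace

variable {E : Type*} [PseudoMetricSpace E]

instance : CoeFun (SkorokhodSpace E) (fun _ => ℝ≥0 → E) := ⟨toFun⟩

/-- Pairs `(x, y)` of paths such that, for some increasing bijection `τ` of `[0, ∞)`, one has
`|τ(u) - u| ≤ ε` and `d(x(u), y(τ(u))) ≤ ε` for all `u ∈ [0, a]`. -/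
def entourage (E : Type*) [PseudoMetricSpace E] (a ε : ℝ≥0) :
    Set (SkorokhodSpace E × SkorokhodSpace E) :=
  {p | ∃ τ : ℝ≥0 ≃o ℝ≥0, ∀ u ≤ a, dist (τ u) u ≤ ε ∧ dist (p.1 u) (p.2 (τ u)) ≤ ε}

theorem entourage_mono {a b δ ε : ℝ≥0} (hab : a ≤ b) (hδ : δ ≤ ε) :
    entourage E b δ ⊆ entourage E a ε := by
  rintro p ⟨τ, h⟩
  refine ⟨τ, fun u hu => ?_⟩
  obtain ⟨h₁, h₂⟩ := h u (hu.trans hab)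
  exact ⟨h₁.trans (by exact_mod_cast hδ), h₂.trans (by exact_mod_cast hδ)⟩

/-- The sets `entourage E a ε`, `a ≥ 0`, `ε > 0`, form a filter basis. -/
def entourageBasis (E : Type*) [PseudoMetricSpace E] :
    FilterBasis (SkorokhodSpace E × SkorokhodSpace E) where
  sets := {s | ∃ a ε : ℝ≥0, 0 < ε ∧ s = entourage E a ε}
  nonempty := ⟨_, 0, 1, one_pos, rfl⟩
  inter_sets := by
    rintro _ _ ⟨a, ε, hε, rfl⟩ ⟨b, δ, hδ, rfl⟩
    exact ⟨_, ⟨max a b, min ε δ, lt_min hε hδ, rfl⟩, Set.subset_inter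
      (entourage_mono (le_max_left _ _) (min_le_left _ _))
      (entourage_mono (le_max_right _ _) (min_le_right _ _))⟩

/-- The uniform structure generated by the sets `entourage E a ε`, `a ≥ 0`, `ε > 0`. Its topology
is Skorokhod's `J₁`-topology: `xₙ → x` if and only if for every `a` there are increasing
bijections `τₙ` of `[0, ∞)` with `sup_{u ≤ a} |τₙ(u) - u| → 0` and
`sup_{u ≤ a} d(xₙ(u), x(τₙ(u))) → 0`. -/
instance instUniformSpace : UniformSpace (SkorokhodSpace E) :=
  UniformSpace.ofCore <| UniformSpace.Core.mkOfBasis (entourageBasis E)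
    (by
      rintro _ ⟨a, ε, hε, rfl⟩ x
      exact ⟨OrderIso.refl _, fun u _ => by simp⟩)
    (by
      rintro _ ⟨a, ε, hε, rfl⟩
      refine ⟨_, ⟨a + ε, ε, hε, rfl⟩, ?_⟩
      rintro ⟨x, y⟩ ⟨τ, h⟩
      refine ⟨τ.symm, fun u hu => ?_⟩
      have hu' : τ.symm u ≤ a + ε := by
        rw [OrderIso.symm_apply_le]
        refine hu.trans ?_
        have h₁ := (h (a + ε) le_rfl).1
        rw [NNReal.dist_eq, NNReal.coe_add] at h₁
        have h₂ := (abs_le.1 h₁).1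
        rw [← NNReal.coe_le_coe]
        linarith
      obtain ⟨h₁, h₂⟩ := h _ hu'
      rw [OrderIso.apply_symm_apply] at h₁ h₂
      exact ⟨by rwa [dist_comm], by rwa [dist_comm]⟩)
    (by
      rintro _ ⟨a, ε, hε, rfl⟩
      refine ⟨_, ⟨a + ε, ε / 2, half_pos hε, rfl⟩, ?_⟩
      rintro ⟨x, z⟩ ⟨y, ⟨τ, h⟩, ⟨σ, k⟩⟩
      refine ⟨τ.trans σ, fun u hu => ?_⟩
      obtain ⟨h₁, h₂⟩ := h u (hu.trans le_self_add)
      have hτ : τ u ≤ a + ε := by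
        have h₃ := h₁
        rw [NNReal.dist_eq, NNReal.coe_div, NNReal.coe_ofNat] at h₃
        replace h₃ := (abs_le.1 h₃).2
        have hu' : (u : ℝ) ≤ a := by exact_mod_cast hu
        have hε' : (0 : ℝ) < ε := by exact_mod_cast hε
        rw [← NNReal.coe_le_coe]
        rw [NNReal.coe_add]
        linarith
      obtain ⟨k₁, k₂⟩ := k _ hτ
      have h₄ := dist_triangle (σ (τ u)) (τ u) u
      have h₅ := dist_triangle (x u) (y (τ u)) (z (σ (τ u)))
      push_cast at h₁ h₂ k₁ k₂
      exact ⟨by simp only [OrderIso.trans_apply]; linarith,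
        by simp only [OrderIso.trans_apply]; linarith⟩)

/-- The Borel σ-algebra of the `J₁`-topology. -/
instance instMeasurableSpace : MeasurableSpace (SkorokhodSpace E) := borel _

instance instBorelSpace : BorelSpace (SkorokhodSpace E) := ⟨rfl⟩

end SkorokhodSpace

/-! ### Order statistics -/

/-- The `(j+1)`-th largest element of the finite family (multiset) `s`, and `0` if `s` has at most
`j` elements. -/
def nthLargest (s : Multiset ℝ≥0) (j : ℕ) : ℝ≥0 := (s.sort (· ≥ ·)).getD j 0

/-- The set `B_{u,t}^y` of pairs `(f, v) ∈ C₀⁺ × [0, ∞)` with `f(t) ≥ y` and `v ≤ u`, where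
`f ∈ C₀⁺` is written as `f = r s` with `0 < r < ∞` and `s` in the unit sphere. -/
def exceedanceSet {T : Type*} [TopologicalSpace T] (u : ℝ≥0) (t : T) (y : ℝ≥0) :
    Set (PolarSpace T × ℝ≥0) :=
  {p | p.1.radius ≠ ∞ ∧ (y : ℝ≥0∞) ≤ p.1.radius * (p.1.angle t : ℝ≥0∞) ∧ p.2 ≤ u}

/-- The `(j+1)`-th space-time order statistic `sup {y ≥ 0 : μ(B_{u,t}^y) ≥ j + 1}` of a point
measure `μ`; the supremum of the empty set is `0`. -/
def spaceTimeOrderStat {T : Type*} [TopologicalSpace T] [CompactSpace T]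
    (μ : Measure (PolarSpace T × ℝ≥0)) (j : ℕ) (u : ℝ≥0) (t : T) : ℝ≥0 :=
  sSup {y : ℝ≥0 | ((j + 1 : ℕ) : ℝ≥0∞) ≤ μ (exceedanceSet u t y)}

end

set_option linter.unusedSectionVars false

noncomputable section


/-! ### Order statistics of families of nonnegative numbers -/

/-! Both processes are the same functional of a family of functions carrying time marks: in row `n`
the function with index `i` gets the mark `(i+1)/n`, an atom of the Poisson process gets its time
coordinate, and the value at time `u` consists of the order statistics of the members marked in
`[0,u]` (`orderPath`). Up to a uniform error `ε` only members exceeding `ε` somewhere matter. Their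
polar coordinates lie in a bounded set `S`, so up to any finite time there are finitely many of
them.

This permits a discretisation. Take `S` with `ν`-null boundary and cover it, up to a part of small
`ν`-mass, by finitely many `ν`-continuity cells on each of which the functions are within `ε` of a
fixed `g l`. Cut the time axis up to a horizon into `m` intervals of length `h`. Unless some
interval receives two points of `S`, or a point of the uncovered part, the configuration is
described by a pattern, which assigns to each interval either nothing or one cell. On the event of a
given pattern the path is `J₁`-close to a deterministic path, with the functions `g l` placed at the
midpoints: a time change moves each large point to the midpoint of its interval at cost `h`, and
replacing the functions costs `ε` (`orderPath_patternPath_mem_entourage`).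

For the array, the probability of a pattern is a product over independent blocks of binomial-type
terms (`measureReal_blockEvent`). Since `n P[X_n ∈ A] → ν(A)` for bounded continuity sets
(`TendstoSharpWeakly.tendsto_measureReal`), it converges to the probability of the same pattern for
the Poisson process (`IsPoissonPointProcess.measureReal_iInter_poissonBlockEvent`). For the Poisson
process the exceptional event has small probability, two points in one interval costing `O(h²)` per
interval. Because there are finitely many patterns and their probabilities converge, the exceptional
event is small for the array too.

`HasFiniteApproximation` records this situation. It yields convergence of the expectations of
bounded uniformly continuous functions, and also the almost everywhere measurability of the limit
(`tendstoInDistribution_of_hasFiniteApproximation`). -/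

/-- The `(j+1)`-th largest value of the family `a`. -/
def orderStat {ι : Type*} (a : ι → ℝ≥0) (j : ℕ) : ℝ≥0 :=
  sSup {y | ((j + 1 : ℕ) : ℕ∞) ≤ {i | y ≤ a i}.encard}

/-- If every member of `a` above `ε` is matched injectively to a member of `b` that is at most `ε`
lower, then `j+1` members of `a` at level `y > ε` give `j+1` members of `b` at level `y - ε`.
Members of `a` below `ε` need no partner, since levels `y ≤ ε` are absorbed by the error.
Boundedness of `b` is needed because an unbounded supremum in `ℝ≥0` is `0` by convention. -/
theorem orderStat_le_add {ι κ : Type*} {a : ι → ℝ≥0} {b : κ → ℝ≥0} {ε : ℝ≥0}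
    (hb : BddAbove (Set.range b)) (R : ι → κ → Prop)
    (hR : ∀ i, ε < a i → ∃ k, R i k ∧ a i ≤ b k + ε)
    (hR' : ∀ i i' k, R i k → R i' k → i = i') (j : ℕ) :
    orderStat a j ≤ orderStat b j + ε := by
  refine csSup_le' fun y hy => ?_
  rcases le_or_gt y ε with h | h
  · exact h.trans le_add_self
  · rw [← tsub_le_iff_right]
    obtain ⟨C, hC⟩ := hb
    refine le_csSup ⟨C, ?_⟩ ?_
    · intro z hz
      have hz' : {k | z ≤ b k}.encard ≠ 0 := by
        intro h0
        simp only [Set.mem_ofPred_eq, h0] at hz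
        simp at hz
      rw [Set.encard_ne_zero] at hz'
      obtain ⟨k, hk⟩ := hz'
      exact le_trans hk (hC ⟨k, rfl⟩)
    · refine le_trans (show ((j + 1 : ℕ) : ℕ∞) ≤ _ from hy) ?_
      have : ∀ i : {i | y ≤ a i}, ∃ k, R i k ∧ a i ≤ b k + ε := fun i => hR i (h.trans_le i.2)
      choose φ hφ using this
      have hinj : Function.Injective φ := fun i i' hii =>
        Subtype.ext (hR' _ _ (φ i) (hφ i).1 (hii ▸ (hφ i').1))
      rw [Set.encard, ENat.card_congr (Equiv.ofInjective φ hinj)]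
      refine Set.encard_le_encard ?_
      rintro _ ⟨i, _, rfl⟩
      exact tsub_le_iff_right.2 (le_trans i.2 (hφ i).2)

theorem orderStat_le_add_of_le {ι : Type*} {a b : ι → ℝ≥0} {ε : ℝ≥0}
    (hb : BddAbove (Set.range b)) (h : ∀ i, ε < a i → a i ≤ b i + ε) (j : ℕ) :
    orderStat a j ≤ orderStat b j + ε :=
  orderStat_le_add hb (fun i k => i = k) (fun i hi => ⟨i, rfl, h i hi⟩)
    (fun _ _ _ h h' => h.trans h'.symm) j

/-- Adding `0` never changes a supremum in `ℝ≥0`, not even in the empty or unbounded case. Level `0`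
has to be ignored because there the zeros used for padding are counted too. -/
theorem sSup_eq_of_pos {S S' : Set ℝ≥0} (h : ∀ y, 0 < y → (y ∈ S ↔ y ∈ S')) :
    sSup S = sSup S' := by
  have key : ∀ S : Set ℝ≥0, sSup S = sSup (S ∪ {0}) := by
    intro S
    by_cases hb : BddAbove S
    · rcases S.eq_empty_or_nonempty with rfl | hne
      · simp
      · rw [csSup_union hb hne (bddAbove_singleton) (Set.singleton_nonempty _)]
        simp
    · rw [NNReal.sSup_of_not_bddAbove hb, NNReal.sSup_of_not_bddAbove]
      exact fun h => hb (h.mono Set.subset_union_left)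
  rw [key S, key S']
  congr 1
  ext y
  rcases eq_or_ne y 0 with rfl | hy
  · simp
  · simp [hy, h y (pos_iff_ne_zero.2 hy)]

/-- In a decreasing list the entries that are at least `y` form an initial segment. The default `0`
of `getD` is harmless because `y > 0`. -/
theorem succ_le_countP_iff {l : List ℝ≥0} (hl : l.Pairwise (· ≥ ·)) {y : ℝ≥0} (hy : 0 < y) (j : ℕ) :
    j + 1 ≤ l.countP (fun x => y ≤ x) ↔ y ≤ l.getD j 0 := by
  induction l generalizing j with
  | nil =>
    change j + 1 ≤ 0 ↔ y ≤ 0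
    simp [hy.ne']
  | cons x l ih =>
    rw [List.pairwise_cons] at hl
    by_cases hx : y ≤ x
    · rw [List.countP_cons_of_pos (by simpa using hx), Nat.add_le_add_iff_right]
      cases j with
      | zero =>
        change _ ↔ y ≤ x
        simp [hx]
      | succ j => exact ih hl.2 j
    · have h0 : l.countP (fun x => y ≤ x) = 0 := by
        rw [List.countP_eq_zero]
        intro z hz
        simp only [decide_eq_true_eq, not_le]
        exact lt_of_le_of_lt (hl.1 z hz) (not_le.1 hx)
      have h1 : ¬ y ≤ (x :: l).getD j 0 := by
        cases j with
        | zero => exact hx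
        | succ j => exact (ih hl.2 j).not.1 (by omega)
      rw [List.countP_cons_of_neg (by simpa using hx), h0]
      exact iff_of_false (by omega) h1

theorem nthLargest_map_range (k : ℕ) (x : ℕ → ℝ≥0) (j : ℕ) :
    nthLargest ((Multiset.range k).map x) j = orderStat (fun i => if i < k then x i else 0) j := by
  set s := (Multiset.range k).map x with hs
  have hl : (s.sort (· ≥ ·)).Pairwise (· ≥ ·) := Multiset.pairwise_sort s (· ≥ ·)
  have hsup : nthLargest s j = sSup {y | y ≤ nthLargest s j} := csSup_Iic.symm
  rw [hsup, orderStat]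
  refine sSup_eq_of_pos fun y hy => ?_
  simp only [Set.mem_ofPred_eq]
  rw [nthLargest, ← succ_le_countP_iff hl hy]
  have h1 : (s.sort (· ≥ ·)).countP (fun x => y ≤ x) = s.countP (fun x => y ≤ x) := by
    conv_rhs => rw [← Multiset.sort_eq s (· ≥ ·)]
    rw [Multiset.coe_countP]
  have h2 : {i | y ≤ if i < k then x i else 0} = ((Finset.range k).filter (fun i => y ≤ x i) : Set ℕ) := by
    ext i
    by_cases hi : i < k <;> simp [hi, hy.ne']
  rw [h1, h2, Set.encard_coe_eq_coe_finsetCard, Nat.cast_le, hs, Multiset.countP_map]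
  rfl

/-! ### Order statistics of families of functions -/

theorem exists_nnreal_pos_lt {δ : ℝ} (hδ : 0 < δ) : ∃ ε : ℝ≥0, 0 < ε ∧ (ε : ℝ) < δ :=
  ⟨⟨δ / 2, (half_pos hδ).le⟩, half_pos hδ, half_lt_self hδ⟩

section Families

variable {T : Type*} [MetricSpace T] [CompactSpace T]

theorem CPlus.apply_le_supNorm (x : CPlus T) (t : T) : x t ≤ x.supNorm :=
  le_ciSup x.bddAbove_range t

theorem CPlus.dist_le_iff {x y : CPlus T} {ε : ℝ≥0} :
    dist x y ≤ ε ↔ ∀ t, x t ≤ y t + ε ∧ y t ≤ x t + ε := by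
  have h := ContinuousMap.dist_le (f := x) (g := y) (C := (ε : ℝ)) ε.2
  refine h.trans ?_
  refine forall_congr' fun t => ?_
  rw [NNReal.dist_eq, abs_le, ← NNReal.coe_le_coe, ← NNReal.coe_le_coe]
  push_cast
  constructor
  · rintro ⟨h1, h2⟩; constructor <;> linarith
  · rintro ⟨h1, h2⟩; constructor <;> linarith

/-- Only finitely many members of the family `f` exceed a given level. -/
def FinitelyLarge {ι : Type*} (f : ι → CPlus T) : Prop :=
  ∀ ε : ℝ≥0, 0 < ε → {i | ∃ t, ε < f i t}.Finite

theorem FinitelyLarge.bddAbove {ι : Type*} {f : ι → CPlus T} (hf : FinitelyLarge f) (t : T) :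
    BddAbove (Set.range fun i => f i t) := by
  have hfin := hf 1 one_pos
  obtain ⟨C, hC⟩ := (hfin.image fun i => (f i).supNorm).bddAbove
  refine ⟨max C 1, ?_⟩
  rintro _ ⟨i, rfl⟩
  by_cases hi : ∃ t, 1 < f i t
  · exact le_max_of_le_left (((f i).apply_le_supNorm t).trans (hC ⟨i, hi, rfl⟩))
  · push Not at hi
    exact le_max_of_le_right (hi t)

/-- The pointwise order statistic of a family of functions. -/
def orderStatFun {ι : Type*} (f : ι → CPlus T) (hf : FinitelyLarge f) (j : ℕ) : CPlus T where
  toFun t := orderStat (fun i => f i t) j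
  continuous_toFun := by
    rw [continuous_iff_continuousAt]
    intro t
    rw [ContinuousAt, Metric.tendsto_nhds]
    intro δ hδ
    obtain ⟨ε, hε, hεδ⟩ : ∃ ε : ℝ≥0, 0 < ε ∧ (ε : ℝ) < δ := exists_nnreal_pos_lt hδ
    have hfin := hf ε hε
    -- Only the finitely many members exceeding `ε` somewhere have to be controlled near `t`; this
    -- replaces equicontinuity of the whole family.
    have hnear : ∀ᶠ t' in 𝓝 t, ∀ i ∈ {i | ∃ t, ε < f i t}, dist (f i t') (f i t) < ε := by
      rw [eventually_all_finite hfin]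
      intro i _
      exact Metric.tendsto_nhds.1 ((f i).continuous.tendsto t) ε hε
    filter_upwards [hnear] with t' ht'
    have key : ∀ i ∈ {i | ∃ t, ε < f i t}, f i t' ≤ f i t + ε ∧ f i t ≤ f i t' + ε := by
      intro i hi
      have := ht' i hi
      rw [NNReal.dist_eq, abs_lt] at this
      constructor <;> rw [← NNReal.coe_le_coe] <;> push_cast <;> linarith
    have h1 := orderStat_le_add_of_le (hf.bddAbove t) (a := fun i => f i t') (ε := ε)
      (fun i hi => (key i ⟨t', hi⟩).1) j
    have h2 := orderStat_le_add_of_le (hf.bddAbove t') (a := fun i => f i t) (ε := ε)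
      (fun i hi => (key i ⟨t, hi⟩).2) j
    rw [← NNReal.coe_le_coe] at h1 h2
    push_cast at h1 h2
    rw [NNReal.dist_eq, abs_lt]
    constructor <;> linarith

/-- The two matchings `R` and `R'` do not depend on `t`, but whether a member needs its partner
does: only where it exceeds `ε`. -/
theorem dist_orderStatFun_le {ι κ : Type*} {f : ι → CPlus T} {g : κ → CPlus T}
    (hf : FinitelyLarge f) (hg : FinitelyLarge g) {ε : ℝ≥0} (R R' : ι → κ → Prop)
    (hR : ∀ i t, ε < f i t → ∃ k, R i k ∧ f i t ≤ g k t + ε)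
    (hR' : ∀ k t, ε < g k t → ∃ i, R' i k ∧ g k t ≤ f i t + ε)
    (hRu : ∀ i i' k, R i k → R i' k → i = i') (hRu' : ∀ i k k', R' i k → R' i k' → k = k')
    (j : ℕ) : dist (orderStatFun f hf j) (orderStatFun g hg j) ≤ ε := by
  rw [CPlus.dist_le_iff]
  intro t
  exact ⟨orderStat_le_add (hg.bddAbove t) R (fun i hi => hR i t hi) hRu j,
    orderStat_le_add (hf.bddAbove t) (fun k i => R' i k) (fun k hk => hR' k t hk)
      (fun k k' i => hRu' i k k') j⟩

theorem dist_orderStatFun_le_of_le {ι : Type*} {f g : ι → CPlus T}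
    (hf : FinitelyLarge f) (hg : FinitelyLarge g) {ε : ℝ≥0}
    (h : ∀ i t, ε < f i t → f i t ≤ g i t + ε) (h' : ∀ i t, ε < g i t → g i t ≤ f i t + ε)
    (j : ℕ) : dist (orderStatFun f hf j) (orderStatFun g hg j) ≤ ε :=
  dist_orderStatFun_le hf hg (fun i k => i = k) (fun i k => i = k)
    (fun i t hi => ⟨i, rfl, h i t hi⟩) (fun i t hi => ⟨i, rfl, h' i t hi⟩)
    (fun _ _ _ h h' => h.trans h'.symm) (fun _ _ _ h h' => h.symm.trans h') j

/-- The members of the family `f` with mark in `J`, the others being replaced by `0`. -/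
def restrictFamily {ι : Type*} (f : ι → CPlus T) (v : ι → ℝ≥0) (J : Set ℝ≥0) (i : ι) : CPlus T :=
  open Classical in if v i ∈ J then f i else 0

theorem restrictFamily_of_mem {ι : Type*} {f : ι → CPlus T} {v : ι → ℝ≥0} {J : Set ℝ≥0} {i : ι}
    (h : v i ∈ J) : restrictFamily f v J i = f i := if_pos h

theorem restrictFamily_of_notMem {ι : Type*} {f : ι → CPlus T} {v : ι → ℝ≥0} {J : Set ℝ≥0} {i : ι}
    (h : v i ∉ J) : restrictFamily f v J i = 0 := if_neg h

theorem lt_restrictFamily_iff {ι : Type*} {f : ι → CPlus T} {v : ι → ℝ≥0} {J : Set ℝ≥0} {i : ι}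
    {ε : ℝ≥0} {t : T} : ε < restrictFamily f v J i t ↔ v i ∈ J ∧ ε < f i t := by
  by_cases h : v i ∈ J
  · simp [restrictFamily_of_mem h, h]
  · simp [restrictFamily_of_notMem h, h]

/-- Up to any time, only finitely many members of the marked family exceed a given level. -/
def LocallyFinitelyLarge {ι : Type*} (f : ι → CPlus T) (v : ι → ℝ≥0) : Prop :=
  ∀ u ε : ℝ≥0, 0 < ε → {i | v i ≤ u ∧ ∃ t, ε < f i t}.Finite

theorem LocallyFinitelyLarge.restrict {ι : Type*} {f : ι → CPlus T} {v : ι → ℝ≥0}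
    (h : LocallyFinitelyLarge f v) {J : Set ℝ≥0} (hJ : BddAbove J) :
    FinitelyLarge (restrictFamily f v J) := by
  obtain ⟨u, hu⟩ := hJ
  intro ε hε
  refine (h u ε hε).subset ?_
  rintro i ⟨t, ht⟩
  rw [lt_restrictFamily_iff] at ht
  exact ⟨hu ht.1, t, ht.2⟩

theorem dist_orderStatFun_restrict_le {ι : Type*} {f : ι → CPlus T} {v : ι → ℝ≥0} {J J' : Set ℝ≥0}
    (hf : FinitelyLarge (restrictFamily f v J)) (hf' : FinitelyLarge (restrictFamily f v J'))
    {ε : ℝ≥0} (h : ∀ i, (∃ t, ε < f i t) → (v i ∈ J ↔ v i ∈ J')) (j : ℕ) :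
    dist (orderStatFun _ hf j) (orderStatFun _ hf' j) ≤ ε := by
  refine dist_orderStatFun_le_of_le hf hf' ?_ ?_ j
  · intro i t hi
    rw [lt_restrictFamily_iff] at hi
    rw [restrictFamily_of_mem hi.1, restrictFamily_of_mem ((h i ⟨t, hi.2⟩).1 hi.1)]
    exact le_self_add
  · intro i t hi
    rw [lt_restrictFamily_iff] at hi
    rw [restrictFamily_of_mem hi.1, restrictFamily_of_mem ((h i ⟨t, hi.2⟩).2 hi.1)]
    exact le_self_add

/-- Finitely many large members have marks in `(u, u + 1]`, so none of these marks lies immediately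
to the right of `u`. Up to error `ε` the path is therefore constant there. -/
theorem LocallyFinitelyLarge.exists_gap_right {ι : Type*} {f : ι → CPlus T} {v : ι → ℝ≥0}
    (h : LocallyFinitelyLarge f v) (u ε : ℝ≥0) (hε : 0 < ε) :
    ∃ w, u < w ∧ ∀ i, (∃ t, ε < f i t) → u < v i → w ≤ v i := by
  have hfin := h (u + 1) ε hε
  have hev : ∀ᶠ w in 𝓝[>] u, ∀ i ∈ {i | v i ≤ u + 1 ∧ ∃ t, ε < f i t}, u < v i → w ≤ v i := by
    rw [eventually_all_finite hfin]
    intro i _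
    by_cases hi : u < v i
    · filter_upwards [Ioc_mem_nhdsGT hi] with w hw _ using hw.2
    · exact Eventually.of_forall fun w h' => absurd h' hi
  obtain ⟨w, hw, hw'⟩ := (hev.and (Ioc_mem_nhdsGT (lt_add_one u))).exists
  refine ⟨w, hw'.1, fun i hi hui => ?_⟩
  by_cases hi' : v i ≤ u + 1
  · exact hw i ⟨hi', hi⟩ hui
  · exact hw'.2.trans (not_le.1 hi').le

theorem LocallyFinitelyLarge.eventually_gap_left {ι : Type*} {f : ι → CPlus T} {v : ι → ℝ≥0}
    (h : LocallyFinitelyLarge f v) (u ε : ℝ≥0) (hε : 0 < ε) :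
    ∀ᶠ w in 𝓝[<] u, ∀ i, (∃ t, ε < f i t) → v i < u → v i ≤ w := by
  have hfin := h u ε hε
  have hev : ∀ᶠ w in 𝓝[<] u, ∀ i ∈ {i | v i ≤ u ∧ ∃ t, ε < f i t}, v i < u → v i ≤ w := by
    rw [eventually_all_finite hfin]
    intro i _
    by_cases hi : v i < u
    · filter_upwards [Ico_mem_nhdsLT hi] with w hw _ using hw.1
    · exact Eventually.of_forall fun w h' => absurd h' hi
  filter_upwards [hev] with w hw i hi hiu using hw i ⟨hiu.le, hi⟩ hiu

/-- The path whose value at time `u` is formed by the first `r` order statistics of the members of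
the family `f` with marks in `[0, u]`. -/
def orderPath {ι : Type*} (f : ι → CPlus T) (v : ι → ℝ≥0) (h : LocallyFinitelyLarge f v) (r : ℕ) :
    SkorokhodSpace (Fin r → CPlus T) where
  toFun u j := orderStatFun _ (h.restrict (bddAbove_Iic (a := u))) j
  right_continuous u := by
    rw [ContinuousWithinAt, tendsto_pi_nhds]
    intro j
    rw [Metric.tendsto_nhds]
    intro δ hδ
    obtain ⟨ε, hε, hεδ⟩ : ∃ ε : ℝ≥0, 0 < ε ∧ (ε : ℝ) < δ := exists_nnreal_pos_lt hδ
    obtain ⟨w, huw, hw⟩ := h.exists_gap_right u ε hε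
    filter_upwards [Ico_mem_nhdsGE huw] with u' hu'
    refine lt_of_le_of_lt (dist_orderStatFun_restrict_le _ _ (ε := ε) ?_ j) hεδ
    intro i hi
    simp only [Set.mem_Iic]
    refine ⟨fun h' => ?_, fun h' => h'.trans hu'.1⟩
    by_contra hlt
    exact absurd (hw i hi (not_le.1 hlt)) (not_le.2 (h'.trans_lt hu'.2))
  left_limits u := by
    -- The left limit forgets the members marked exactly `u`.
    refine ⟨fun j => orderStatFun _ (h.restrict (bddAbove_Iio (a := u))) j, ?_⟩
    rw [tendsto_pi_nhds]
    intro j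
    rw [Metric.tendsto_nhds]
    intro δ hδ
    obtain ⟨ε, hε, hεδ⟩ : ∃ ε : ℝ≥0, 0 < ε ∧ (ε : ℝ) < δ := exists_nnreal_pos_lt hδ
    filter_upwards [h.eventually_gap_left u ε hε, self_mem_nhdsWithin] with w hw hwu
    refine lt_of_le_of_lt (dist_orderStatFun_restrict_le _ _ (ε := ε) ?_ j) hεδ
    intro i hi
    exact ⟨fun h' => Set.mem_Iio.2 (lt_of_le_of_lt h' hwu), fun h' => hw i hi h'⟩

theorem orderPath_apply {ι : Type*} (f : ι → CPlus T) (v : ι → ℝ≥0) (h : LocallyFinitelyLarge f v)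
    (r : ℕ) (u : ℝ≥0) (j : Fin r) (t : T) :
    orderPath f v h r u j t = orderStat (fun i => if v i ≤ u then f i t else 0) j := by
  change orderStat _ _ = _
  congr 1
  ext i
  by_cases hi : v i ≤ u
  · rw [restrictFamily_of_mem hi, if_pos hi]
  · rw [restrictFamily_of_notMem hi, if_neg hi]
    rfl

theorem orderPath_apply_eq {ι : Type*} (f : ι → CPlus T) (v : ι → ℝ≥0)
    (h : LocallyFinitelyLarge f v) (r : ℕ) (u : ℝ≥0) (j : Fin r) :
    orderPath f v h r u j = orderStatFun _ (h.restrict (bddAbove_Iic (a := u))) j := rfl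

end Families


/-! ### Time changes -/

theorem exists_orderIso_nnreal {f : ℝ → ℝ} (hmono : StrictMono f) (hsurj : Function.Surjective f)
    (h0 : f 0 = 0) : ∃ σ : ℝ≥0 ≃o ℝ≥0, ∀ x : ℝ≥0, (σ x : ℝ) = f x := by
  have hnn : ∀ x : ℝ≥0, 0 ≤ f x := fun x => h0 ▸ hmono.monotone x.2
  let g : ℝ≥0 → ℝ≥0 := fun x => ⟨f x, hnn x⟩
  have hg : StrictMono g := fun x y hxy => NNReal.coe_lt_coe.1 (hmono (NNReal.coe_lt_coe.2 hxy))
  have hgs : Function.Surjective g := by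
    intro y
    obtain ⟨x, hx⟩ := hsurj y
    have hx0 : 0 ≤ x := by
      rw [← hmono.le_iff_le, h0, hx]
      exact y.2
    exact ⟨⟨x, hx0⟩, NNReal.coe_injective hx⟩
  exact ⟨hg.orderIsoOfSurjective g hgs, fun x => rfl⟩

/-- The graph is the broken line through `(c,c)`, `(v,w)`, `(d,d)`, continued by the diagonal. For
`w ≤ v` it is convex on `[c,d]` and below the diagonal, which gives a closed formula; the case `v ≤
w` is obtained by inversion. -/
theorem exists_orderIso_bump_of_le {c d v w : ℝ≥0} (hv : c < v) (hv' : v < d) (hw : c < w)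
    (hwv : w ≤ v) :
    ∃ σ : ℝ≥0 ≃o ℝ≥0, σ v = w ∧ (∀ x ≤ c, σ x = x) ∧ ∀ x, d ≤ x → σ x = x := by
  rw [← NNReal.coe_lt_coe] at hv hv' hw
  rw [← NNReal.coe_le_coe] at hwv
  set s₁ : ℝ := ((w : ℝ) - c) / (v - c) with hs₁
  set s₂ : ℝ := ((d : ℝ) - w) / (d - v) with hs₂
  have h₁ : 0 < s₁ := div_pos (by linarith) (by linarith)
  have h₁' : s₁ ≤ 1 := (div_le_one (by linarith)).2 (by linarith)
  have h₂ : 1 ≤ s₂ := (one_le_div (by linarith)).2 (by linarith)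
  have e₁ : s₁ * (v - c) = w - c := div_mul_cancel₀ _ (by linarith)
  have e₂ : s₂ * (d - v) = d - w := div_mul_cancel₀ _ (by linarith)
  -- The two lines pass through `(v,w)` with slopes `s₁ ≤ 1 ≤ s₂`. Their maximum is the broken line,
  -- and the minimum with `x` restores the identity outside `[c,d]`.
  let f : ℝ → ℝ := fun x => min x (max (w + (x - v) * s₁) (w + (x - v) * s₂))
  have hfmono : StrictMono f := by
    intro x y hxy
    exact min_lt_min hxy (max_lt_max (by nlinarith) (by nlinarith))
  have hlow : ∀ x : ℝ, x ≤ c → f x = x := by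
    intro x hx
    refine min_eq_left (le_max_of_le_left ?_)
    nlinarith
  have hhigh : ∀ x : ℝ, d ≤ x → f x = x := by
    intro x hx
    refine min_eq_left (le_max_of_le_right ?_)
    nlinarith
  have hfcont : Continuous f := by fun_prop
  have htop : Tendsto f atTop atTop :=
    tendsto_id.congr' ((eventually_ge_atTop (d : ℝ)).mono fun x hx => (hhigh x hx).symm)
  have hbot : Tendsto f atBot atBot :=
    tendsto_id.congr' ((eventually_le_atBot (c : ℝ)).mono fun x hx => (hlow x hx).symm)
  obtain ⟨σ, hσ⟩ := exists_orderIso_nnreal hfmono (hfcont.surjective htop hbot) (hlow 0 c.2)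
  refine ⟨σ, ?_, fun x hx => ?_, fun x hx => ?_⟩
  · rw [← NNReal.coe_inj, hσ]
    simp only [f, sub_self, zero_mul, add_zero, max_self]
    exact min_eq_right hwv
  · rw [← NNReal.coe_inj, hσ]
    exact hlow _ (by exact_mod_cast hx)
  · rw [← NNReal.coe_inj, hσ]
    exact hhigh _ (by exact_mod_cast hx)

theorem exists_orderIso_bump {c d v w : ℝ≥0} (hv : c < v) (hv' : v < d) (hw : c < w)
    (hw' : w < d) :
    ∃ σ : ℝ≥0 ≃o ℝ≥0, σ v = w ∧ (∀ x ≤ c, σ x = x) ∧ ∀ x, d ≤ x → σ x = x := by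
  rcases le_total w v with h | h
  · exact exists_orderIso_bump_of_le hv hv' hw h
  · obtain ⟨σ, h₁, h₂, h₃⟩ := exists_orderIso_bump_of_le hw hw' hv h
    refine ⟨σ.symm, ?_, fun x hx => ?_, fun x hx => ?_⟩ <;> rw [OrderIso.symm_apply_eq]
    · exact h₁.symm
    · exact (h₂ x hx).symm
    · exact (h₃ x hx).symm

/-- One bump per cell, composed successively; each bump is the identity off its own cell, so grid
points and points already placed stay put. -/
theorem exists_timeChange (h : ℝ≥0) (m : ℕ) (v w : ℕ → ℝ≥0)
    (hv : ∀ b < m, v b ∈ Set.Ioo (b * h) ((b + 1) * h))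
    (hw : ∀ b < m, w b ∈ Set.Ioo (b * h) ((b + 1) * h)) :
    ∃ τ : ℝ≥0 ≃o ℝ≥0, (∀ b < m, τ (v b) = w b) ∧ ∀ b : ℕ, τ (b * h) = b * h := by
  induction m with
  | zero => exact ⟨OrderIso.refl _, by simp, by simp⟩
  | succ m ih =>
    obtain ⟨τ, h₁, h₂⟩ := ih (fun b hb => hv b (hb.trans (Nat.lt_succ_self m)))
      (fun b hb => hw b (hb.trans (Nat.lt_succ_self m)))
    have hvm := hv m (Nat.lt_succ_self m)
    have hwm := hw m (Nat.lt_succ_self m)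
    have h₂' : τ ((m + 1) * h) = (m + 1) * h := by exact_mod_cast h₂ (m + 1)
    -- The bump starts from `τ (v m)`, since `τ` is only known to fix the grid; this still keeps `τ
    -- (v m)` inside cell `m`.
    obtain ⟨σ, s₁, s₂, s₃⟩ := exists_orderIso_bump (c := m * h) (d := (m + 1) * h) (v := τ (v m))
      (w := w m) (by rw [← h₂ m]; exact τ.strictMono hvm.1)
      (by rw [← h₂']; exact τ.strictMono hvm.2) hwm.1 hwm.2
    refine ⟨τ.trans σ, fun b hb => ?_, fun b => ?_⟩
    · rw [OrderIso.trans_apply]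
      rcases Nat.lt_succ_iff_lt_or_eq.1 hb with hb' | rfl
      · rw [h₁ b hb']
        refine s₂ _ ((hw b hb).2.le.trans ?_)
        gcongr
        exact_mod_cast hb'
      · exact s₁
    · rw [OrderIso.trans_apply, h₂]
      rcases le_or_gt b m with hb | hb
      · refine s₂ _ ?_
        gcongr
      · refine s₃ _ ?_
        gcongr
        exact_mod_cast hb

theorem exists_mem_Ioc_grid {h u : ℝ≥0} (hh : 0 < h) (hu : 0 < u) :
    ∃ b : ℕ, u ∈ Set.Ioc (b * h) ((b + 1) * h) := by
  have hpos : 0 < u / h := div_pos hu hh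
  have hc : 0 < ⌈u / h⌉₊ := Nat.ceil_pos.2 hpos
  refine ⟨⌈u / h⌉₊ - 1, ?_, ?_⟩
  · rw [← lt_div_iff₀ hh]
    exact Nat.lt_ceil.1 (Nat.sub_lt hc one_pos)
  · rw [← div_le_iff₀ hh]
    have : ((⌈u / h⌉₊ - 1 : ℕ) : ℝ≥0) + 1 = (⌈u / h⌉₊ : ℝ≥0) := by
      rw [← Nat.cast_add_one, Nat.sub_add_cancel hc]
    rw [this]
    exact Nat.le_ceil _

theorem Ioc_grid_unique {h u : ℝ≥0} {b b' : ℕ} (hb : u ∈ Set.Ioc (b * h) ((b + 1) * h))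
    (hb' : u ∈ Set.Ioc (b' * h) ((b' + 1) * h)) : b = b' := by
  have key : ∀ b b' : ℕ, u ∈ Set.Ioc (b * h) ((b + 1) * h) →
      u ∈ Set.Ioc (b' * h) ((b' + 1) * h) → b ≤ b' := by
    intro b b' hb hb'
    have h1 : (b : ℝ≥0) * h < (b' + 1) * h := hb.1.trans_le hb'.2
    have h2 := lt_of_mul_lt_mul_right h1 zero_le
    have h3 : b < b' + 1 := by exact_mod_cast h2
    omega
  exact le_antisymm (key _ _ hb hb') (key _ _ hb' hb)

/-- A time change fixing the grid maps each cell onto itself, so no point moves by more than the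
cell length. -/
theorem dist_timeChange_le {h : ℝ≥0} (hh : 0 < h) {τ : ℝ≥0 ≃o ℝ≥0}
    (hτ : ∀ b : ℕ, τ (b * h) = b * h) (u : ℝ≥0) : dist (τ u) u ≤ h := by
  rcases eq_zero_or_pos u with rfl | hu
  · have := hτ 0
    simp only [Nat.cast_zero, zero_mul] at this
    simp [this]
  · obtain ⟨b, hb⟩ := exists_mem_Ioc_grid hh hu
    have h1 : (b * h : ℝ≥0) ≤ τ u := hτ b ▸ τ.monotone hb.1.le
    have h2 : τ u ≤ (b + 1) * h := by
      have := hτ (b + 1)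
      rw [Nat.cast_add_one] at this
      exact this ▸ τ.monotone hb.2
    obtain ⟨h3, h4⟩ := hb
    rw [← NNReal.coe_le_coe] at h1 h2 h4
    rw [← NNReal.coe_lt_coe] at h3
    push_cast at h1 h2 h3 h4
    rw [NNReal.dist_eq, abs_le]
    constructor <;> linarith

/-! ### Comparison of a path with a discretised path -/

section Patterns

variable {T : Type*} [MetricSpace T] [CompactSpace T]

theorem LocallyFinitelyLarge.of_finite {ι : Type*} [Finite ι] (f : ι → CPlus T) (v : ι → ℝ≥0) :
    LocallyFinitelyLarge f v := fun _ _ _ => Set.toFinite _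

/-- The path of order statistics of at most one function in each of `m` time cells of length `h`,
placed in the middle of the cell. -/
def patternPath {m : ℕ} (q : Fin m → Option (CPlus T)) (h : ℝ≥0) (r : ℕ) :
    SkorokhodSpace (Fin r → CPlus T) :=
  orderPath (fun b => (q b).getD 0) (fun b => ((b : ℕ) + 1 / 2) * h)
    (LocallyFinitelyLarge.of_finite _ _) r

/-- The deterministic core of the proof. The time change sends the mark of the large member of each
occupied cell to the midpoint; by monotonicity that mark is at most `u` exactly when the midpoint is
at most `τ u`, so at corresponding times the same pairs are present. The mark must lie in the open
cell, as grid points are fixed, and marks at time `0` are treated apart because they belong to no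
cell. -/
theorem orderPath_patternPath_mem_entourage {ι : Type*} {f : ι → CPlus T} {v : ι → ℝ≥0}
    (hf : LocallyFinitelyLarge f v) {m : ℕ} {q : Fin m → Option (CPlus T)} {h ε a : ℝ≥0}
    (hh : 0 < h) (ha : a ≤ m * h)
    (hzero : ∀ i, v i = 0 → ∀ t, f i t ≤ ε)
    (hnone : ∀ b : Fin m, q b = none → ∀ i, v i ∈ Set.Ioc ((b : ℕ) * h) (((b : ℕ) + 1) * h) →
      ∀ t, f i t ≤ ε)
    (hsome : ∀ (b : Fin m) g, q b = some g →
      ∃ i, v i ∈ Set.Ioo ((b : ℕ) * h) (((b : ℕ) + 1) * h) ∧ dist (f i) g ≤ ε ∧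
        ∀ i', v i' ∈ Set.Ioc ((b : ℕ) * h) (((b : ℕ) + 1) * h) → i' ≠ i → ∀ t, f i' t ≤ ε)
    (r : ℕ) :
    (orderPath f v hf r, patternPath q h r) ∈
      SkorokhodSpace.entourage (Fin r → CPlus T) a (max ε h) := by
  choose k hk using hsome
  have hmid : ∀ b : ℕ, ((b : ℝ≥0) + 1 / 2) * h ∈ Set.Ioo (b * h) ((b + 1) * h) := by
    intro b
    constructor
    · exact mul_lt_mul_of_pos_right (lt_add_of_pos_right _ (by positivity)) hh
    · refine mul_lt_mul_of_pos_right (add_lt_add_right ?_ _) hh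
      rw [← NNReal.coe_lt_coe]
      norm_num
  obtain ⟨τ, hτ, hτ'⟩ : ∃ τ : ℝ≥0 ≃o ℝ≥0,
      (∀ (b : Fin m) g (hg : q b = some g), τ (v (k b g hg)) = ((b : ℕ) + 1 / 2) * h) ∧
      ∀ b : ℕ, τ (b * h) = b * h := by
    classical
    -- In cells without a large member the midpoint is sent to itself.
    let v' : ℕ → ℝ≥0 := fun b =>
      if hb : ∃ (hb : b < m) (g : CPlus T), q ⟨b, hb⟩ = some g then
        v (k ⟨b, hb.choose⟩ hb.choose_spec.choose hb.choose_spec.choose_spec)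
      else (b + 1 / 2) * h
    obtain ⟨τ, h₁, h₂⟩ := exists_timeChange h m v' (fun b => (b + 1 / 2) * h)
      (fun b hb => by
        by_cases hb' : ∃ (hb : b < m) (g : CPlus T), q ⟨b, hb⟩ = some g
        · simp only [v', dif_pos hb']
          exact (hk ⟨b, hb'.choose⟩ hb'.choose_spec.choose hb'.choose_spec.choose_spec).1
        · simp only [v', dif_neg hb']
          exact hmid b)
      (fun b _ => hmid b)
    refine ⟨τ, fun b g hg => ?_, h₂⟩
    rw [← h₁ b b.2]
    have hb' : ∃ (hb : (b : ℕ) < m) (g : CPlus T), q ⟨b, hb⟩ = some g := ⟨b.2, g, hg⟩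
    simp only [v', dif_pos hb']
    have key : ∀ g' (hg' : q b = some g'), v (k b g' hg') = v (k b g hg) := by
      intro g' hg'
      obtain rfl : g = g' := Option.some.inj (hg.symm.trans hg')
      rfl
    exact congrArg τ (key _ hb'.choose_spec.choose_spec).symm
  refine ⟨τ, fun u hu => ⟨(dist_timeChange_le hh hτ' u).trans ?_, ?_⟩⟩
  · exact_mod_cast le_max_right ε h
  refine le_trans ?_ (show (ε : ℝ) ≤ (max ε h : ℝ≥0) by exact_mod_cast le_max_left ε h)
  refine (dist_pi_le_iff ε.2).2 fun j => ?_
  rw [patternPath, orderPath_apply_eq, orderPath_apply_eq]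
  refine dist_orderStatFun_le _ _ (fun i b => ∃ g hg, i = k b g hg)
    (fun i b => ∃ g hg, i = k b g hg) ?_ ?_ ?_ ?_ j
  · intro i t hi
    rw [lt_restrictFamily_iff] at hi
    obtain ⟨hiu, hit⟩ := hi
    rw [restrictFamily_of_mem hiu]
    have hiu' : v i ≤ u := hiu
    have hpos : 0 < v i := by
      rw [pos_iff_ne_zero]
      exact fun h0 => absurd (hzero i h0 t) (not_le.2 hit)
    obtain ⟨b, hb⟩ := exists_mem_Ioc_grid hh hpos
    have hbm : b < m := by
      have h1 : (b : ℝ≥0) * h < m * h := hb.1.trans_le (hiu'.trans (hu.trans ha))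
      exact_mod_cast lt_of_mul_lt_mul_right h1 zero_le
    rcases hq : q ⟨b, hbm⟩ with _ | g
    · exact absurd (hnone ⟨b, hbm⟩ hq i hb t) (not_le.2 hit)
    · have hik : i = k ⟨b, hbm⟩ g hq := by
        by_contra hne
        exact absurd ((hk ⟨b, hbm⟩ g hq).2.2 i hb hne t) (not_le.2 hit)
      refine ⟨⟨b, hbm⟩, ⟨g, hq, hik⟩, ?_⟩
      rw [restrictFamily_of_mem, hq, Option.getD_some]
      · have := (hk ⟨b, hbm⟩ g hq).2.1
        rw [← hik, CPlus.dist_le_iff] at this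
        exact (this t).1
      · rw [Set.mem_Iic, ← hτ ⟨b, hbm⟩ g hq, ← hik]
        exact τ.monotone hiu'
  · intro b t hb
    rw [lt_restrictFamily_iff] at hb
    obtain ⟨hbu, hbt⟩ := hb
    rw [restrictFamily_of_mem (v := fun b : Fin m => ((b : ℕ) + 1 / 2) * h) hbu]
    obtain hq | ⟨g, hq⟩ := Option.eq_none_or_eq_some (q b)
    · rw [hq] at hbt
      simp at hbt
    · refine ⟨k b g hq, ⟨g, hq, rfl⟩, ?_⟩
      rw [restrictFamily_of_mem, hq, Option.getD_some]
      · have := (hk b g hq).2.1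
        rw [CPlus.dist_le_iff] at this
        exact (this t).2
      · rw [Set.mem_Iic] at hbu ⊢
        rw [← hτ b g hq] at hbu
        exact τ.le_iff_le.1 hbu
  · rintro i i' b ⟨g, hg, rfl⟩ ⟨g', hg', rfl⟩
    obtain rfl : g = g' := Option.some.inj (hg.symm.trans hg')
    rfl
  · rintro i b b' ⟨g, hg, rfl⟩ ⟨g', hg', he⟩
    have h1 := (hk b g hg).1
    have h2 := (hk b' g' hg').1
    rw [← he] at h2
    exact Fin.ext (Ioc_grid_unique ⟨h1.1, h1.2.le⟩ ⟨h2.1, h2.2.le⟩)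

/-! ### Order statistics of a triangular array -/

/-- For `n = 0` all marks are `0` by the convention for division, so the family is set to `0`; this
agrees with the empty family prescribed by `⌊0 * u⌋₊ = 0`. -/
theorem locallyFinitelyLarge_array (n : ℕ) (x : ℕ → CPlus T) :
    LocallyFinitelyLarge (fun i => if n = 0 then 0 else x i) (fun i => ((i : ℝ≥0) + 1) / n) := by
  intro u ε hε
  rcases eq_or_ne n 0 with rfl | hn
  · simp
  · refine (Set.finite_lt_nat ⌊n * u⌋₊).subset ?_
    rintro i ⟨hi, _⟩
    rw [div_le_iff₀ (by positivity), mul_comm] at hi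
    have : i + 1 ≤ ⌊n * u⌋₊ := Nat.le_floor (by exact_mod_cast hi)
    exact this

/-- The path of the first `r` order statistics of `x 0, …, x (⌊nu⌋ - 1)`. -/
def arrayPath (n r : ℕ) (x : ℕ → CPlus T) : SkorokhodSpace (Fin r → CPlus T) :=
  orderPath _ _ (locallyFinitelyLarge_array n x) r

theorem div_le_iff_lt_floor {n : ℕ} (hn : n ≠ 0) (i : ℕ) (u : ℝ≥0) :
    ((i : ℝ≥0) + 1) / n ≤ u ↔ i < ⌊n * u⌋₊ := by
  rw [div_le_iff₀ (by positivity), mul_comm, ← Nat.succ_le_iff, Nat.le_floor_iff zero_le, Nat.cast_succ]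

theorem arrayPath_apply (n r : ℕ) (x : ℕ → CPlus T) (u : ℝ≥0) (j : Fin r) (t : T) :
    arrayPath n r x u j t =
      nthLargest ((Multiset.range ⌊(n : ℝ≥0) * u⌋₊).map fun i => x i t) j := by
  rw [nthLargest_map_range, arrayPath, orderPath_apply]
  congr 1
  ext i
  rcases eq_or_ne n 0 with rfl | hn
  · simp
  · simp only [div_le_iff_lt_floor hn, if_neg hn]

/-! ### Countable basis of the Skorokhod uniformity and measurability of the array paths. -/

theorem SkorokhodSpace.hasBasis_uniformity (E : Type*) [PseudoMetricSpace E] :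
    (uniformity (SkorokhodSpace E)).HasBasis (fun p : ℝ≥0 × ℝ≥0 => 0 < p.2)
      (fun p => entourage E p.1 p.2) := by
  refine (entourageBasis E).hasBasis.to_hasBasis ?_ ?_
  · rintro _ ⟨a, ε, hε, rfl⟩
    exact ⟨(a, ε), hε, subset_rfl⟩
  · rintro ⟨a, ε⟩ hε
    exact ⟨_, ⟨a, ε, hε, rfl⟩, subset_rfl⟩

/-- This makes the `J₁`-topology pseudometrizable, as needed for measurability of almost sure limits
and for testing weak convergence on Lipschitz functions. -/
instance SkorokhodSpace.isCountablyGenerated_uniformity (E : Type*) [PseudoMetricSpace E] :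
    (uniformity (SkorokhodSpace E)).IsCountablyGenerated := by
  have : (uniformity (SkorokhodSpace E)).HasBasis (fun _ : ℕ => True)
      (fun k => entourage E (k : ℝ≥0) (1 / ((k : ℝ≥0) + 1))) := by
    refine (SkorokhodSpace.hasBasis_uniformity E).to_hasBasis ?_ ?_
    · rintro ⟨a, ε⟩ hε
      obtain ⟨k₁, hk₁⟩ := exists_nat_ge a
      obtain ⟨k₂, hk₂⟩ := exists_nat_one_div_lt (show 0 < ε from hε)
      refine ⟨max k₁ k₂, trivial, entourage_mono (hk₁.trans ?_) (le_trans ?_ hk₂.le)⟩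
      · exact_mod_cast le_max_left _ _
      · gcongr
        exact_mod_cast le_max_right _ _
    · intro k _
      exact ⟨(k, 1 / ((k : ℝ≥0) + 1)), by positivity, subset_rfl⟩
  exact this.isCountablyGenerated

/-- Up to time `a` only finitely many coordinates enter, and the identity serves as time change.
Continuity in the product topology gives Borel measurability without any description of the Borel
sets of the Skorokhod space. -/
theorem continuous_arrayPath (n r : ℕ) : Continuous (arrayPath (T := T) n r) := by
  rw [continuous_iff_continuousAt]
  intro x
  rw [ContinuousAt, (nhds_basis_uniformity' (SkorokhodSpace.hasBasis_uniformity _)).tendsto_right_iff]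
  rintro ⟨a, ε⟩ hε
  have hnear : ∀ᶠ y in 𝓝 x, ∀ i ∈ {i : ℕ | i < ⌊n * a⌋₊}, dist (x i) (y i) < ε := by
    rw [eventually_all_finite (Set.finite_lt_nat _)]
    intro i _
    have := ((continuous_apply (A := fun _ => CPlus T) i).tendsto x)
    filter_upwards [Metric.tendsto_nhds.1 this ε (by exact_mod_cast hε)] with y hy
    rwa [dist_comm]
  filter_upwards [hnear] with y hy
  refine ⟨OrderIso.refl _, fun u hu => ⟨by simp, ?_⟩⟩
  rw [OrderIso.refl_apply]
  refine (dist_pi_le_iff ε.2).2 fun j => ?_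
  rw [arrayPath, arrayPath, orderPath_apply_eq, orderPath_apply_eq]
  rcases eq_or_ne n 0 with rfl | hn
  · refine dist_orderStatFun_le_of_le _ _ ?_ ?_ j
    all_goals
      intro i t hi
      rw [lt_restrictFamily_iff] at hi
      simp at hi
  · have key : ∀ i : ℕ, ((i : ℝ≥0) + 1) / n ∈ Set.Iic u → ∀ t, x i t ≤ y i t + ε ∧ y i t ≤ x i t + ε := by
      intro i hi
      rw [← CPlus.dist_le_iff]
      have hi' : ((i : ℝ≥0) + 1) / n ≤ a := le_trans hi hu
      rw [div_le_iff_lt_floor hn] at hi'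
      exact (hy i hi').le
    refine dist_orderStatFun_le_of_le _ _ ?_ ?_ j
    · intro i t hi
      rw [lt_restrictFamily_iff] at hi
      rw [restrictFamily_of_mem (v := fun i : ℕ => ((i : ℝ≥0) + 1) / n) hi.1,
        restrictFamily_of_mem (v := fun i : ℕ => ((i : ℝ≥0) + 1) / n) hi.1, if_neg hn, if_neg hn]
      exact (key i hi.1 t).1
    · intro i t hi
      rw [lt_restrictFamily_iff] at hi
      rw [restrictFamily_of_mem (v := fun i : ℕ => ((i : ℝ≥0) + 1) / n) hi.1,
        restrictFamily_of_mem (v := fun i : ℕ => ((i : ℝ≥0) + 1) / n) hi.1, if_neg hn, if_neg hn]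
      exact (key i hi.1 t).2

theorem measurable_arrayPath (n r : ℕ) : Measurable (arrayPath (T := T) n r) :=
  (continuous_arrayPath n r).measurable

/-! ### Order statistics of a point measure -/

/-- The function `r s` represented by the point `(r, s)`, and `0` if `r = ∞`. -/
def PolarSpace.toCPlus (p : PolarSpace T) : CPlus T := p.radius.toNNReal • p.angle

theorem PolarSpace.toCPlus_apply (p : PolarSpace T) (t : T) :
    p.toCPlus t = p.radius.toNNReal * p.angle t := rfl

theorem PolarSpace.angle_le_one (p : PolarSpace T) (t : T) : p.angle t ≤ 1 :=
  p.supNorm_angle ▸ p.angle.apply_le_supNorm t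

theorem PolarSpace.toCPlus_le_radius (p : PolarSpace T) (t : T) :
    (p.toCPlus t : ℝ≥0∞) ≤ p.radius := by
  rw [toCPlus_apply]
  refine le_trans ?_ (ENNReal.coe_toNNReal_le_self)
  rw [ENNReal.coe_le_coe]
  exact mul_le_of_le_one_right zero_le (p.angle_le_one t)

/-- Bounded in the metric `d` means bounded away from the zero function: `1/r ≤ 1/c`, while two
angles are at distance at most `1`. -/
theorem PolarSpace.isBounded_le_radius {c : ℝ≥0∞} (hc : 0 < c) :
    Bornology.IsBounded {p : PolarSpace T | c ≤ p.radius} := by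
  rw [Metric.isBounded_iff]
  refine ⟨(c⁻¹).toReal + 1, fun p hp q hq => ?_⟩
  change |(p.radius⁻¹).toReal - (q.radius⁻¹).toReal| + dist p.angle q.angle ≤ _
  have hr : ∀ p : PolarSpace T, c ≤ p.radius → (p.radius⁻¹).toReal ≤ (c⁻¹).toReal := fun p hp =>
    ENNReal.toReal_mono (ENNReal.inv_ne_top.2 hc.ne') (ENNReal.inv_le_inv.2 hp)
  have h1 := hr p hp
  have h2 := hr q hq
  have h1' : 0 ≤ (p.radius⁻¹).toReal := ENNReal.toReal_nonneg
  have h2' : 0 ≤ (q.radius⁻¹).toReal := ENNReal.toReal_nonneg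
  refine add_le_add (abs_le.2 ⟨by linarith, by linarith⟩) ?_
  have h3 : dist p.angle q.angle ≤ (1 : ℝ≥0) := by
    rw [CPlus.dist_le_iff]
    exact fun t => ⟨(p.angle_le_one t).trans le_add_self, (q.angle_le_one t).trans le_add_self⟩
  simpa using h3

theorem locallyFinitelyLarge_of_finite_preimage {ι : Type*} {x : ι → PolarSpace T × ℝ≥0}
    (hx : ∀ B : Set (PolarSpace T × ℝ≥0), Bornology.IsBounded B → {i | x i ∈ B}.Finite) :
    LocallyFinitelyLarge (fun i => (x i).1.toCPlus) (fun i => (x i).2) := by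
  intro u ε hε
  refine (hx ({p | (ε : ℝ≥0∞) ≤ p.radius} ×ˢ Set.Iic u)
    ((PolarSpace.isBounded_le_radius (by exact_mod_cast hε)).prod ?_)).subset ?_
  · exact (Metric.isBounded_Icc 0 u).subset fun y hy => ⟨zero_le, hy⟩
  · rintro i ⟨hi, t, ht⟩
    refine ⟨?_, hi⟩
    refine le_trans ?_ ((x i).1.toCPlus_le_radius t)
    exact_mod_cast ht.le

/-- Valid for every set `S`, measurable or not, because the sum is countable and singletons are
measurable; the exceedance sets thus need no measurability proof. -/
theorem sum_dirac_apply {ι E : Type*} [Countable ι] [MeasurableSpace E] [MeasurableSingletonClass E]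
    (x : ι → E) (S : Set E) :
    (Measure.sum fun i => Measure.dirac (x i)) S = ({i | x i ∈ S}.encard : ℝ≥0∞) := by
  rw [Measure.sum_apply_of_countable]
  have : ∀ i, Measure.dirac (x i) S = Set.indicator {i | x i ∈ S} 1 i := by
    intro i
    rw [Measure.dirac_apply]
    rfl
  simp_rw [this]
  rw [← tsum_subtype]
  simp only [Pi.one_apply]
  rw [ENNReal.tsum_one]
  rfl

theorem spaceTimeOrderStat_sum_dirac {ι : Type*} [Countable ι] (x : ι → PolarSpace T × ℝ≥0)
    (j : ℕ) (u : ℝ≥0) (t : T) :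
    spaceTimeOrderStat (Measure.sum fun i => Measure.dirac (x i)) j u t =
      orderStat (fun i => if (x i).2 ≤ u then (x i).1.toCPlus t else 0) j := by
  have : MeasurableSingletonClass (PolarSpace T × ℝ≥0) := inferInstance
  refine sSup_eq_of_pos fun y hy => ?_
  rw [Set.mem_ofPred_eq, Set.mem_ofPred_eq, sum_dirac_apply]
  have : {i | x i ∈ exceedanceSet u t y} =
      {i | y ≤ if (x i).2 ≤ u then (x i).1.toCPlus t else 0} := by
    ext i
    simp only [exceedanceSet, Set.mem_ofPred_eq]
    by_cases hu : (x i).2 ≤ u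
    · by_cases hr : (x i).1.radius = ∞
      · simp [hr, hu, PolarSpace.toCPlus_apply, hy.ne']
      · simp only [hr, hu, ne_eq, not_false_eq_true, true_and, and_true, if_true,
          PolarSpace.toCPlus_apply]
        rw [← ENNReal.coe_le_coe, ENNReal.coe_mul, ENNReal.coe_toNNReal hr]
    · simp [hu, hy.ne']
  rw [this]
  norm_cast

end Patterns


/-! ### Convergence in distribution through finite discretisations -/

section Discretisation

/-- The random elements `Y n` and `Y'` can simultaneously be approximated, up to the entourage `V`
and an event of probability at most `η` in the limit, by finitely many values that are taken with
convergent probabilities. -/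
def HasFiniteApproximation {D : Type*} {Ω : ℕ → Type*} [∀ n, MeasurableSpace (Ω n)]
    (P : (n : ℕ) → Measure (Ω n)) (Y : (n : ℕ) → Ω n → D)
    {Ω' : Type*} [MeasurableSpace Ω'] (P' : Measure Ω') (Y' : Ω' → D)
    (V : Set (D × D)) (η : ℝ) : Prop :=
  ∃ (p : ℕ) (y : Fin p → D) (A : (n : ℕ) → Fin p → Set (Ω n)) (A' : Fin p → Set Ω'),
    (∀ n k, MeasurableSet (A n k)) ∧ (∀ k, MeasurableSet (A' k)) ∧
    (∀ n, Pairwise (Function.onFun Disjoint (A n))) ∧ Pairwise (Function.onFun Disjoint A') ∧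
    (∀ᶠ n in atTop, ∀ k, ∀ᵐ ω ∂P n, ω ∈ A n k → (Y n ω, y k) ∈ V) ∧
    (∀ k, ∀ᵐ ω ∂P', ω ∈ A' k → (Y' ω, y k) ∈ V) ∧
    (∀ k, Tendsto (fun n => (P n).real (A n k)) atTop (𝓝 (P'.real (A' k)))) ∧
    P'.real (⋃ k, A' k)ᶜ ≤ η

/-- The value `y k` on `A k`, and `y₀` outside all `A k`. -/
theorem exists_measurable_eq_on {D Ω : Type*} [MeasurableSpace D] [MeasurableSpace Ω] {p : ℕ}
    (y : Fin p → D) (y₀ : D) {A : Fin p → Set Ω} (hA : ∀ k, MeasurableSet (A k))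
    (hd : Pairwise (Function.onFun Disjoint A)) :
    ∃ Z : Ω → D, Measurable Z ∧ ∀ k, ∀ ω ∈ A k, Z ω = y k := by
  classical
  let κ : Ω → Option (Fin p) := fun ω => if h : ∃ k, ω ∈ A k then some h.choose else none
  have hκ : ∀ k, ∀ ω ∈ A k, κ ω = some k := by
    intro k ω hω
    have h : ∃ k, ω ∈ A k := ⟨k, hω⟩
    simp only [κ, dif_pos h]
    by_contra hne
    exact Set.disjoint_left.1 (hd (fun h' => hne (congrArg some h'))) h.choose_spec hω
  let _ : MeasurableSpace (Option (Fin p)) := ⊤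
  have hκm : Measurable κ := by
    have hsome : ∀ k, κ ⁻¹' {some k} = A k := by
      intro k
      ext ω
      refine ⟨fun h' => ?_, fun h' => hκ k ω h'⟩
      have h' : κ ω = some k := h'
      by_cases h : ∃ k, ω ∈ A k
      · have := hκ _ ω h.choose_spec
        rw [h'] at this
        rw [Option.some.inj this]
        exact h.choose_spec
      · simp [κ, dif_neg h] at h'
    refine measurable_to_countable' fun o => ?_
    rcases o with _ | k
    · have : κ ⁻¹' {none} = (⋃ k, A k)ᶜ := by
        ext ω
        simp only [Set.mem_preimage, Set.mem_singleton_iff, Set.mem_compl_iff, Set.mem_iUnion]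
        constructor
        · rintro h ⟨k, hk⟩
          rw [hκ k ω hk] at h
          simp at h
        · intro h
          simp only [κ, dif_neg h]
      rw [this]
      exact (MeasurableSet.iUnion hA).compl
    · rw [hsome]
      exact hA k
  refine ⟨fun ω => (κ ω).elim y₀ y, ?_, fun k ω hω => ?_⟩
  · exact (measurable_from_top (f := fun o : Option (Fin p) => o.elim y₀ y)).comp hκm
  · simp only [hκ k ω hω, Option.elim_some]

/-- On each `A k` the integrand is within `κ` of a constant; off their union it is bounded by `C`.
-/
theorem abs_integral_sub_sum_le {Ω : Type*} [MeasurableSpace Ω] {P : Measure Ω}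
    [IsProbabilityMeasure P] {F : Ω → ℝ} (hF : AEStronglyMeasurable F P) {C κ : ℝ} (hκ : 0 ≤ κ)
    (hC : ∀ ω, |F ω| ≤ C) {p : ℕ} {A : Fin p → Set Ω} (hA : ∀ k, MeasurableSet (A k))
    (hd : Pairwise (Function.onFun Disjoint A)) (c : Fin p → ℝ)
    (hc : ∀ k, ∀ᵐ ω ∂P, ω ∈ A k → |F ω - c k| ≤ κ) :
    |∫ ω, F ω ∂P - ∑ k, P.real (A k) * c k| ≤ κ + C * P.real (⋃ k, A k)ᶜ := by
  have hFi : Integrable F P := Integrable.of_bound hF C (ae_of_all _ hC)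
  have hU : MeasurableSet (⋃ k, A k) := MeasurableSet.iUnion hA
  have h1 : ∫ ω, F ω ∂P = ∑ k, ∫ ω in A k, F ω ∂P + ∫ ω in (⋃ k, A k)ᶜ, F ω ∂P := by
    rw [← integral_add_compl hU hFi, integral_iUnion_fintype hA hd (fun k => hFi.integrableOn)]
  have h2 : |∫ ω in (⋃ k, A k)ᶜ, F ω ∂P| ≤ C * P.real (⋃ k, A k)ᶜ := by
    have := norm_setIntegral_le_of_norm_le_const (μ := P) (s := (⋃ k, A k)ᶜ) (f := F) (C := C)
      (measure_lt_top _ _) (fun ω _ => hC ω)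
    exact this
  have h3 : ∀ k, |∫ ω in A k, F ω ∂P - P.real (A k) * c k| ≤ κ * P.real (A k) := by
    intro k
    have e : ∫ ω in A k, F ω ∂P - P.real (A k) * c k = ∫ ω in A k, (F ω - c k) ∂P := by
      rw [integral_sub hFi.integrableOn (integrable_const _), setIntegral_const, smul_eq_mul]
    rw [e]
    exact norm_setIntegral_le_of_norm_le_const_ae' (f := fun ω => F ω - c k)
      (measure_lt_top _ _) (hc k)
  have h4 : ∑ k, P.real (A k) ≤ 1 := by
    rw [← measureReal_iUnion_fintype hd hA]
    exact measureReal_le_one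
  have h5 : |∑ k, (∫ ω in A k, F ω ∂P - P.real (A k) * c k)| ≤ κ := by
    refine (Finset.abs_sum_le_sum_abs _ _).trans ((Finset.sum_le_sum fun k _ => h3 k).trans ?_)
    rw [← Finset.mul_sum]
    exact mul_le_of_le_one_right hκ h4
  have e : ∫ ω, F ω ∂P - ∑ k, P.real (A k) * c k =
      ∑ k, (∫ ω in A k, F ω ∂P - P.real (A k) * c k) + ∫ ω in (⋃ k, A k)ᶜ, F ω ∂P := by
    rw [h1, Finset.sum_sub_distrib]
    ring
  rw [e]
  exact (abs_add_le _ _).trans (add_le_add h5 h2)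

variable {D : Type*} [UniformSpace D] [(uniformity D).IsCountablyGenerated] [MeasurableSpace D]
  [BorelSpace D] {Ω : ℕ → Type*} [∀ n, MeasurableSpace (Ω n)]
  {P : (n : ℕ) → Measure (Ω n)} [∀ n, IsProbabilityMeasure (P n)] {Y : (n : ℕ) → Ω n → D}
  {Ω' : Type*} [MeasurableSpace Ω'] {P' : Measure Ω'} [IsProbabilityMeasure P'] {Y' : Ω' → D}

/-- Finitely valued measurable approximations along a decreasing basis of entourages, with error
probabilities `2⁻ᵏ`, converge to `Y'` almost surely by Borel–Cantelli. No measurable dependence of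
`Y'` on the underlying point process has to be checked. -/
theorem aemeasurable_of_hasFiniteApproximation
    (h : ∀ V ∈ uniformity D, ∀ η > 0, HasFiniteApproximation P Y P' Y' V η) :
    AEMeasurable Y' P' := by
  obtain ⟨V, hV⟩ := (uniformity D).exists_antitone_basis
  have hη : ∀ k : ℕ, (0 : ℝ) < (1 / 2) ^ k := fun k => by positivity
  choose p y A A' hA hA' hd hd' hYV hYV' hlim hbad using
    fun k : ℕ => h (V k) (hV.mem k) _ (hη k)
  obtain ⟨ω₀⟩ : Nonempty Ω' := P'.nonempty_of_neZero
  choose Z hZm hZ using fun k => exists_measurable_eq_on (y k) (Y' ω₀) (hA' k) (hd' k)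
  refine aemeasurable_of_tendsto_metrizable_ae atTop (fun k => (hZm k).aemeasurable) ?_
  have hBC : ∀ᵐ ω ∂P', ∀ᶠ k in atTop, ω ∉ (⋃ i, A' k i)ᶜ := by
    refine ae_eventually_notMem ?_
    have hle : ∀ k, P' (⋃ i, A' k i)ᶜ ≤ (1 / 2 : ℝ≥0∞) ^ k := by
      intro k
      rw [← ENNReal.ofReal_toReal (measure_ne_top P' _)]
      refine (ENNReal.ofReal_le_ofReal (hbad k)).trans (le_of_eq ?_)
      rw [ENNReal.ofReal_pow (by norm_num), ENNReal.ofReal_div_of_pos two_pos]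
      simp
    refine ne_top_of_le_ne_top ?_ (ENNReal.tsum_le_tsum hle)
    rw [ENNReal.tsum_geometric]
    simp
  have hall : ∀ᵐ ω ∂P', ∀ k i, ω ∈ A' k i → (Y' ω, y k i) ∈ V k := by
    rw [ae_all_iff]
    intro k
    rw [ae_all_iff]
    exact hYV' k
  filter_upwards [hBC, hall] with ω h1 h2
  rw [(nhds_basis_uniformity' hV.toHasBasis).tendsto_right_iff]
  intro k _
  filter_upwards [h1, eventually_ge_atTop k] with l hl hkl
  rw [Set.notMem_compl_iff, Set.mem_iUnion] at hl
  obtain ⟨i, hi⟩ := hl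
  rw [hZ l i ω hi]
  exact hV.antitone hkl (h2 l i hi)

theorem tendsto_integral_of_hasFiniteApproximation (hY : ∀ n, AEMeasurable (Y n) (P n))
    (h : ∀ V ∈ uniformity D, ∀ η > 0, HasFiniteApproximation P Y P' Y' V η)
    {F : D → ℝ} (hF : UniformContinuous F) {C : ℝ} (hC : ∀ y, |F y| ≤ C) :
    Tendsto (fun n => ∫ ω, F (Y n ω) ∂P n) atTop (𝓝 (∫ ω, F (Y' ω) ∂P')) := by
  have hY' := aemeasurable_of_hasFiniteApproximation h
  obtain ⟨ω₀⟩ : Nonempty Ω' := P'.nonempty_of_neZero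
  have hC0 : 0 ≤ C := (abs_nonneg _).trans (hC (Y' ω₀))
  rw [Metric.tendsto_nhds]
  intro δ hδ
  -- The total error is three times `κ` (two discretisations and the difference of the finite sums),
  -- plus `δ/4` and `δ/8` for the two exceptional events, which is `3δ/4`.
  set κ := δ / 8 with hκ
  set η := δ / (8 * (C + 1)) with hη
  have hκ0 : 0 < κ := by positivity
  have hη0 : 0 < η := by positivity
  have hCη : C * η ≤ δ / 8 := by
    rw [hη, ← mul_div_assoc, div_le_div_iff₀ (by positivity) (by positivity)]
    nlinarith
  obtain ⟨p, y, A, A', hA, hA', hd, hd', hYV, hYV', hlim, hbad⟩ :=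
    h _ (hF (Metric.dist_mem_uniformity hκ0)) η hη0
  -- The exceptional event is bounded only under `P'`; convergence of the finitely many
  -- probabilities carries the bound over to `P n`.
  have hbad_lim : Tendsto (fun n => (P n).real (⋃ k, A n k)ᶜ) atTop (𝓝 (P'.real (⋃ k, A' k)ᶜ)) := by
    have e : ∀ n, (P n).real (⋃ k, A n k)ᶜ = 1 - ∑ k, (P n).real (A n k) := by
      intro n
      rw [probReal_compl_eq_one_sub (MeasurableSet.iUnion (hA n)),
        measureReal_iUnion_fintype (hd n) (hA n)]
    have e' : P'.real (⋃ k, A' k)ᶜ = 1 - ∑ k, P'.real (A' k) := by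
      rw [probReal_compl_eq_one_sub (MeasurableSet.iUnion hA'),
        measureReal_iUnion_fintype hd' hA']
    simp_rw [e, e']
    exact tendsto_const_nhds.sub (tendsto_finsetSum _ fun k _ => hlim k)
  have hsum_lim : Tendsto (fun n => ∑ k, (P n).real (A n k) * F (y k)) atTop
      (𝓝 (∑ k, P'.real (A' k) * F (y k))) :=
    tendsto_finsetSum _ fun k _ => (hlim k).mul_const _
  have h1' := abs_integral_sub_sum_le (P := P') (F := fun ω => F (Y' ω)) (c := fun k => F (y k))
    (hF.continuous.measurable.comp_aemeasurable hY').aestronglyMeasurable hκ0.le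
    (fun ω => hC _) hA' hd' (fun k => by
      filter_upwards [hYV' k] with ω hω hωk using (hω hωk).le)
  have hbad_ev : ∀ᶠ n in atTop, C * (P n).real (⋃ k, A n k)ᶜ < δ / 4 := by
    have : C * P'.real (⋃ k, A' k)ᶜ < δ / 4 :=
      lt_of_le_of_lt ((mul_le_mul_of_nonneg_left hbad hC0).trans hCη) (by linarith)
    exact (hbad_lim.const_mul C).eventually_lt_const this
  filter_upwards [hYV, hbad_ev, Metric.tendsto_nhds.1 hsum_lim κ hκ0] with n hn hnb hns
  have h1 := abs_integral_sub_sum_le (P := P n) (F := fun ω => F (Y n ω)) (c := fun k => F (y k))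
    (hF.continuous.measurable.comp_aemeasurable (hY n)).aestronglyMeasurable hκ0.le
    (fun ω => hC _) (hA n) (hd n) (fun k => by
      filter_upwards [hn k] with ω hω hωk using (hω hωk).le)
  have h2 : C * P'.real (⋃ k, A' k)ᶜ ≤ δ / 8 := (mul_le_mul_of_nonneg_left hbad hC0).trans hCη
  rw [Real.dist_eq] at hns ⊢
  rw [abs_le] at h1 h1'
  rw [abs_lt] at hns ⊢
  constructor <;> linarith [h1.1, h1.2, h1'.1, h1'.2, hns.1, hns.2]

theorem tendstoInDistribution_of_hasFiniteApproximation (hY : ∀ n, AEMeasurable (Y n) (P n))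
    (h : ∀ V ∈ uniformity D, ∀ η > 0, HasFiniteApproximation P Y P' Y' V η) :
    TendstoInDistribution Y atTop Y' P P' := by
  have hY' := aemeasurable_of_hasFiniteApproximation h
  refine ⟨hY, hY', ?_⟩
  let _ : PseudoMetricSpace D := UniformSpace.pseudoMetricSpace D
  refine tendsto_iff_forall_lipschitz_integral_tendsto.2 ?_
  rintro F ⟨C₀, hC₀⟩ ⟨L, hL⟩
  have hFc : UniformContinuous F := hL.uniformContinuous
  obtain ⟨ω₀⟩ : Nonempty Ω' := P'.nonempty_of_neZero
  have hC : ∀ y, |F y| ≤ C₀ + |F (Y' ω₀)| := by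
    intro y
    have h1 := hC₀ y (Y' ω₀)
    rw [Real.dist_eq] at h1
    have h2 := abs_sub_abs_le_abs_sub (F y) (F (Y' ω₀))
    linarith
  have e : ∀ n, ∫ y, F y ∂((P n).map (Y n)) = ∫ ω, F (Y n ω) ∂P n := fun n =>
    integral_map (hY n) hFc.continuous.aestronglyMeasurable
  have e' : ∫ y, F y ∂(P'.map Y') = ∫ ω, F (Y' ω) ∂P' :=
    integral_map hY' hFc.continuous.aestronglyMeasurable
  change Tendsto (fun n => ∫ y, F y ∂((P n).map (Y n))) atTop (𝓝 (∫ y, F y ∂(P'.map Y')))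
  simp_rw [e, e']
  exact tendsto_integral_of_hasFiniteApproximation hY h hFc hC

end Discretisation


/-! ### `♯`-weak convergence and continuity sets -/

section SharpConvergence

variable {E : Type*} [PseudoMetricSpace E] [MeasurableSpace E] [BorelSpace E]

theorem tendsto_integral_of_tendsto_indicator {μ : Measure E} {S B : Set E} (hB : MeasurableSet B)
    (hμB : μ B < ∞) (hS : MeasurableSet S) (F : ℕ → E →ᵇ ℝ) (hF : ∀ k x, |F k x| ≤ 1)
    (hFB : ∀ k x, x ∉ B → F k x = 0)
    (hlim : ∀ x, Tendsto (fun k => F k x) atTop (𝓝 (S.indicator 1 x))) :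
    Tendsto (fun k => ∫ x, F k x ∂μ) atTop (𝓝 (μ.real S)) := by
  rw [← integral_indicator_one hS]
  refine tendsto_integral_of_dominated_convergence (B.indicator 1)
    (fun k => (F k).continuous.aestronglyMeasurable) ?_ (fun k => ae_of_all _ fun x => ?_)
    (ae_of_all _ hlim)
  · exact (integrable_indicator_iff hB).2 (integrableOn_const hμB.ne)
  · by_cases hx : x ∈ B
    · simpa [hx] using hF k x
    · simp [hx, hFB k x hx]

/-- The thickened indicator as a real-valued function. -/
def thickenedIndicatorReal {δ : ℝ} (hδ : 0 < δ) (S : Set E) : E →ᵇ ℝ :=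
  BoundedContinuousFunction.ofNormedAddCommGroup (fun x => (thickenedIndicator hδ S x : ℝ))
    (by fun_prop) 1 (fun x => by
      rw [Real.norm_of_nonneg (NNReal.coe_nonneg _)]
      exact_mod_cast thickenedIndicator_le_one hδ S x)

theorem tendsto_thickenedIndicatorReal (S : Set E) (x : E) :
    Tendsto (fun k : ℕ => thickenedIndicatorReal (δ := 1 / ((k : ℝ) + 1)) (by positivity) S x)
      atTop (𝓝 ((closure S).indicator 1 x)) := by
  have h := thickenedIndicator_tendsto_indicator_closure
    (δseq := fun k : ℕ => 1 / ((k : ℝ) + 1)) (fun k => by positivity)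
    tendsto_one_div_add_atTop_nhds_zero_nat S
  rw [tendsto_pi_nhds] at h
  have h' := (NNReal.continuous_coe.tendsto _).comp (h x)
  have e : (((closure S).indicator (fun _ => (1 : ℝ≥0)) x : ℝ≥0) : ℝ) =
      (closure S).indicator 1 x := by
    by_cases hx : x ∈ closure S <;> simp [hx]
  rw [e] at h'
  exact h'

/-- The portmanteau argument: the indicator of `S` lies between the continuous functions `G k` and
`F k` of bounded support, which converge to the indicators of the interior and of the closure.
Boundedly finite `μ` provides the dominating function. -/
theorem TendstoSharpWeakly.tendsto_measureReal {μs : ℕ → Measure E} {μ : Measure E}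
    (h : TendstoSharpWeakly μs μ) (hμ : IsBoundedlyFinite μ) [∀ n, IsFiniteMeasure (μs n)]
    {S : Set E} (hSb : Bornology.IsBounded S) (hS : MeasurableSet S) (hfr : μ (frontier S) = 0) :
    Tendsto (fun n => (μs n).real S) atTop (𝓝 (μ.real S)) := by
  have hpos : ∀ k : ℕ, (0 : ℝ) < 1 / ((k : ℝ) + 1) := fun k => by positivity
  -- Radii at most `1` keep all supports inside one bounded thickening `B`.
  have hle : ∀ k : ℕ, 1 / ((k : ℝ) + 1) ≤ 1 := fun k =>
    (div_le_one (by positivity)).2 (by linarith [(Nat.cast_nonneg k : (0 : ℝ) ≤ k)])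
  set B := Metric.thickening 1 S with hB
  have hBb : Bornology.IsBounded B := hSb.thickening
  have hBm : MeasurableSet B := Metric.isOpen_thickening.measurableSet
  have hSB : S ⊆ B := Metric.self_subset_thickening one_pos S
  let F : ℕ → E →ᵇ ℝ := fun k => thickenedIndicatorReal (hpos k) S
  let G : ℕ → E →ᵇ ℝ := fun k =>
    BoundedContinuousFunction.const E 1 - thickenedIndicatorReal (hpos k) (interior S)ᶜ
  have hF01 : ∀ k x, 0 ≤ F k x ∧ F k x ≤ 1 := fun k x =>
    ⟨NNReal.coe_nonneg _, NNReal.coe_le_coe.2 (thickenedIndicator_le_one (hpos k) S x)⟩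
  have hG : ∀ k x, G k x = 1 - (thickenedIndicator (hpos k) (interior S)ᶜ x : ℝ) := fun k x => rfl
  have hG01 : ∀ k x, 0 ≤ G k x ∧ G k x ≤ 1 := by
    intro k x
    have h1 : (thickenedIndicator (hpos k) (interior S)ᶜ x : ℝ) ≤ 1 := by
      exact_mod_cast thickenedIndicator_le_one (hpos k) _ x
    have h2 : (0 : ℝ) ≤ (thickenedIndicator (hpos k) (interior S)ᶜ x : ℝ) := NNReal.coe_nonneg _
    rw [hG]
    constructor <;> linarith
  have hFS : ∀ k, ∀ x ∈ S, F k x = 1 := by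
    intro k x hx
    change ((thickenedIndicator (hpos k) S x : ℝ≥0) : ℝ) = 1
    rw [thickenedIndicator_one (hpos k) S hx]
    rfl
  have hGS : ∀ k, ∀ x, x ∉ S → G k x = 0 := by
    intro k x hx
    rw [hG, thickenedIndicator_one (hpos k) _ (Set.mem_compl fun h' => hx (interior_subset h'))]
    simp
  have hFB : ∀ k x, x ∉ B → F k x = 0 := by
    intro k x hx
    change ((thickenedIndicator (hpos k) S x : ℝ≥0) : ℝ) = 0
    rw [thickenedIndicator_zero (hpos k) S (fun h' => hx (Metric.thickening_mono (hle k) S h'))]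
    rfl
  have hFlim : Tendsto (fun k => ∫ x, F k x ∂μ) atTop (𝓝 (μ.real S)) := by
    have e : μ.real S = μ.real (closure S) := by
      rw [measureReal_def, measureReal_def, measure_closure_of_null_frontier hfr]
    rw [e]
    refine tendsto_integral_of_tendsto_indicator hBm (hμ B hBb hBm) isClosed_closure.measurableSet F
      (fun k x => ?_) hFB (tendsto_thickenedIndicatorReal S)
    rw [abs_of_nonneg (hF01 k x).1]
    exact (hF01 k x).2
  have hGlim : Tendsto (fun k => ∫ x, G k x ∂μ) atTop (𝓝 (μ.real S)) := by
    have e : μ.real S = μ.real (interior S) := by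
      rw [measureReal_def, measureReal_def, measure_interior_of_null_frontier hfr]
    rw [e]
    refine tendsto_integral_of_tendsto_indicator hBm (hμ B hBb hBm) isOpen_interior.measurableSet G
      (fun k x => ?_) (fun k x hx => hGS k x fun h' => hx (hSB h')) (fun x => ?_)
    · rw [abs_of_nonneg (hG01 k x).1]
      exact (hG01 k x).2
    · have h1 := (tendsto_thickenedIndicatorReal (interior S)ᶜ x).const_sub 1
      rw [isOpen_interior.isClosed_compl.closure_eq] at h1
      have e : (1 : ℝ) - (interior S)ᶜ.indicator 1 x = (interior S).indicator 1 x := by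
        by_cases hx : x ∈ interior S <;> simp [hx]
      rw [e] at h1
      exact h1
  have hFsupp : ∀ k, Bornology.IsBounded (Function.support (F k)) := fun k =>
    hBb.subset fun x hx => by_contra fun h' => hx (hFB k x h')
  have hGsupp : ∀ k, Bornology.IsBounded (Function.support (G k)) := fun k =>
    hSb.subset fun x hx => by_contra fun h' => hx (hGS k x h')
  have hupper : ∀ k n, (μs n).real S ≤ ∫ x, F k x ∂μs n := by
    intro k n
    rw [← integral_indicator_one hS]
    refine integral_mono ((integrable_indicator_iff hS).2 (integrableOn_const (measure_ne_top _ _)))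
      ((F k).integrable _) fun x => ?_
    by_cases hx : x ∈ S
    · simp [hx, hFS k x hx]
    · simpa [hx] using (hF01 k x).1
  have hlower : ∀ k n, ∫ x, G k x ∂μs n ≤ (μs n).real S := by
    intro k n
    rw [← integral_indicator_one hS]
    refine integral_mono ((G k).integrable _)
      ((integrable_indicator_iff hS).2 (integrableOn_const (measure_ne_top _ _))) fun x => ?_
    by_cases hx : x ∈ S
    · simpa [hx] using (hG01 k x).2
    · simp [hx, hGS k x hx]
  rw [tendsto_order]
  constructor
  · intro a ha
    obtain ⟨k, hk⟩ := (hGlim.eventually_const_lt ha).exists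
    filter_upwards [(h (G k) (hGsupp k)).eventually_const_lt hk] with n hn
    exact hn.trans_le (hlower k n)
  · intro a ha
    obtain ⟨k, hk⟩ := (hFlim.eventually_lt_const ha).exists
    filter_upwards [(h (F k) (hFsupp k)).eventually_lt_const hk] with n hn
    exact (hupper k n).trans_lt hn

end SharpConvergence

/-! ### The polar decomposition -/

section Polar

variable {T : Type*} [MetricSpace T] [CompactSpace T]

theorem PolarSpace.dist_eq (p q : PolarSpace T) :
    dist p q = |(p.radius⁻¹).toReal - (q.radius⁻¹).toReal| + dist p.angle q.angle := rfl

/-- The embedding of `(0, ∞] × S` into `ℝ × C⁺`. -/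
def PolarSpace.embed (p : PolarSpace T) : ℝ × CPlus T := ((p.radius⁻¹).toReal, p.angle)

/-- The metric of the polar space is the sum metric on the image, the product carries the maximum
metric, and the two differ by a factor of at most `2`. Second countability is inherited in this way.
-/
theorem PolarSpace.isUniformInducing_embed :
    IsUniformInducing (PolarSpace.embed : PolarSpace T → ℝ × CPlus T) := by
  have h1 : LipschitzWith 1 (PolarSpace.embed : PolarSpace T → ℝ × CPlus T) := by
    refine LipschitzWith.of_dist_le_mul fun p q => ?_
    rw [Prod.dist_eq, PolarSpace.dist_eq, NNReal.coe_one, one_mul]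
    refine max_le ?_ ?_
    · rw [embed, embed, Real.dist_eq]
      exact le_add_of_nonneg_right dist_nonneg
    · exact le_add_of_nonneg_left (abs_nonneg _)
  have h2 : AntilipschitzWith 2 (PolarSpace.embed : PolarSpace T → ℝ × CPlus T) := by
    refine AntilipschitzWith.of_le_mul_dist fun p q => ?_
    rw [Prod.dist_eq, PolarSpace.dist_eq, NNReal.coe_ofNat, two_mul]
    refine add_le_add ?_ ?_
    · exact le_max_left (dist (embed p).1 (embed q).1) _
    · exact le_max_right _ (dist (embed p).2 (embed q).2)
  exact h2.isUniformInducing h1.uniformContinuous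

theorem PolarSpace.isInducing_embed :
    IsInducing (PolarSpace.embed : PolarSpace T → ℝ × CPlus T) :=
  PolarSpace.isUniformInducing_embed.isInducing

instance PolarSpace.instSecondCountableTopology : SecondCountableTopology (PolarSpace T) :=
  PolarSpace.isInducing_embed.secondCountableTopology

theorem PolarSpace.continuous_angle : Continuous (PolarSpace.angle : PolarSpace T → CPlus T) :=
  continuous_snd.comp PolarSpace.isInducing_embed.continuous

theorem PolarSpace.continuous_inv_radius :
    Continuous (fun p : PolarSpace T => (p.radius⁻¹).toReal) :=
  continuous_fst.comp PolarSpace.isInducing_embed.continuous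

theorem PolarSpace.radius_ne_top_iff (p : PolarSpace T) :
    p.radius ≠ ∞ ↔ (p.radius⁻¹).toReal ≠ 0 := by
  rw [ne_eq, ne_eq, ENNReal.toReal_eq_zero_iff, ENNReal.inv_eq_zero, ENNReal.inv_eq_top]
  simp [p.radius_pos.ne']

theorem PolarSpace.isOpen_radius_ne_top : IsOpen {p : PolarSpace T | p.radius ≠ ∞} := by
  have e : {p : PolarSpace T | p.radius ≠ ∞} = {p | (p.radius⁻¹).toReal ≠ 0} :=
    Set.ext fun p => p.radius_ne_top_iff
  rw [e]
  exact isOpen_ne_fun (PolarSpace.continuous_inv_radius (T := T)) continuous_const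

theorem PolarSpace.continuousAt_toCPlus {p : PolarSpace T} (hp : p.radius ≠ ∞) :
    ContinuousAt (PolarSpace.toCPlus : PolarSpace T → CPlus T) p := by
  have e : (PolarSpace.toCPlus : PolarSpace T → CPlus T) =
      fun p => ((p.radius⁻¹).toReal⁻¹).toNNReal • p.angle := by
    ext p t
    rw [toCPlus]
    congr 3
    rw [← ENNReal.toReal_inv, inv_inv]
    exact (Real.toNNReal_coe).symm
  rw [e]
  have h1 : ContinuousAt (fun p : PolarSpace T => ((p.radius⁻¹).toReal)⁻¹) p :=
    (PolarSpace.continuous_inv_radius.continuousAt).inv₀ ((p.radius_ne_top_iff).1 hp)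
  exact (continuous_real_toNNReal.continuousAt.comp h1).smul
    PolarSpace.continuous_angle.continuousAt

theorem toCPlus_polar (x : {x : CPlus T // x ≠ 0}) : (polar x).toCPlus = x.1 := by
  ext t
  rw [PolarSpace.toCPlus_apply]
  congr 1
  exact mul_div_cancel₀ _ (CPlus.supNorm_ne_zero x.2)

theorem CPlus.continuous_supNorm : Continuous (CPlus.supNorm : CPlus T → ℝ≥0) := by
  have key : ∀ x y : CPlus T, x.supNorm ≤ y.supNorm + nndist x y := by
    intro x y
    refine ciSup_le' fun t => ?_
    have h : dist x y ≤ nndist x y := le_of_eq (coe_nndist x y).symm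
    rw [CPlus.dist_le_iff] at h
    exact (h t).1.trans (add_le_add_left (y.apply_le_supNorm t) _)
  refine LipschitzWith.continuous (K := 1) (LipschitzWith.of_dist_le_mul fun x y => ?_)
  have h1 := key x y
  have h2 := key y x
  rw [nndist_comm y x] at h2
  rw [← NNReal.coe_le_coe] at h1 h2
  push_cast at h1 h2
  rw [NNReal.coe_one, one_mul, NNReal.dist_eq, abs_le]
  constructor <;> linarith

theorem continuous_polar : Continuous (polar : {x : CPlus T // x ≠ 0} → PolarSpace T) := by
  rw [PolarSpace.isInducing_embed.continuous_iff]
  have hs : Continuous fun x : {x : CPlus T // x ≠ 0} => x.1.supNorm :=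
    CPlus.continuous_supNorm.comp continuous_subtype_val
  refine Continuous.prodMk ?_ ?_
  · have e : (fun x : {x : CPlus T // x ≠ 0} => ((polar x).radius⁻¹).toReal) =
        fun x => (x.1.supNorm : ℝ)⁻¹ := by
      ext x
      rw [ENNReal.toReal_inv]
      rfl
    rw [e]
    exact (NNReal.continuous_coe.comp hs).inv₀ fun x =>
      NNReal.coe_ne_zero.2 (CPlus.supNorm_ne_zero x.2)
  · have e : (fun x : {x : CPlus T // x ≠ 0} => (polar x).angle) =
        fun x => (x.1.supNorm)⁻¹ • x.1 := by
      ext x t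
      change ((x.1 t / x.1.supNorm : ℝ≥0) : ℝ) = ((x.1.supNorm⁻¹ * x.1 t : ℝ≥0) : ℝ)
      rw [div_eq_inv_mul]
    rw [e]
    exact (hs.inv₀ fun x => CPlus.supNorm_ne_zero x.2).smul continuous_subtype_val

/-- The nonzero functions whose polar decomposition lies in `S`. -/
def polarPreimage (S : Set (PolarSpace T)) : Set (CPlus T) := Subtype.val '' (polar ⁻¹' S)

theorem mem_polarPreimage {S : Set (PolarSpace T)} {x : CPlus T} :
    x ∈ polarPreimage S ↔ ∃ h : x ≠ 0, polar ⟨x, h⟩ ∈ S := by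
  constructor
  · rintro ⟨⟨x, hx⟩, h, rfl⟩
    exact ⟨hx, h⟩
  · rintro ⟨h, h'⟩
    exact ⟨⟨x, h⟩, h', rfl⟩

theorem measurableSet_ne_zero : MeasurableSet {x : CPlus T | x ≠ 0} :=
  isOpen_ne.measurableSet

theorem measurableSet_polarPreimage {S : Set (PolarSpace T)} (hS : MeasurableSet S) :
    MeasurableSet (polarPreimage S) :=
  (MeasurableEmbedding.subtype_coe measurableSet_ne_zero).measurableSet_image.2
    (continuous_polar.measurable hS)

theorem polarMeasure_apply (μ : Measure (CPlus T)) {S : Set (PolarSpace T)} (hS : MeasurableSet S) :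
    polarMeasure μ S = μ (polarPreimage S) := by
  rw [polarMeasure, Measure.map_apply continuous_polar.measurable hS,
    (MeasurableEmbedding.subtype_coe measurableSet_ne_zero).comap_apply]
  rfl

instance (μ : Measure (CPlus T)) [IsFiniteMeasure μ] : IsFiniteMeasure (polarMeasure μ) := by
  constructor
  rw [polarMeasure_apply μ MeasurableSet.univ]
  exact measure_lt_top _ _

theorem IsBoundedlyFinite.sigmaFinite {ν : Measure (PolarSpace T)} (hν : IsBoundedlyFinite ν) :
    SigmaFinite ν := by
  have : IsLocallyFiniteMeasure ν :=
    ⟨fun p => ⟨Metric.ball p 1, Metric.ball_mem_nhds p one_pos,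
      hν _ Metric.isBounded_ball Metric.isOpen_ball.measurableSet⟩⟩
  infer_instance

/-- A bounded continuity set outside of which all functions are small. -/
theorem exists_exceedance_region (ν : Measure (PolarSpace T)) [SFinite ν] {ε : ℝ≥0} (hε : 0 < ε) :
    ∃ S : Set (PolarSpace T), Bornology.IsBounded S ∧ MeasurableSet S ∧ ν (frontier S) = 0 ∧
      ∀ p ∉ S, ∀ t, p.toCPlus t ≤ ε := by
  -- Frontiers of thickenings of different radii are disjoint, so an s-finite measure charges only
  -- countably many of them.
  obtain ⟨r, hr, hr'⟩ := exists_null_frontier_thickening ν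
    {p : PolarSpace T | (ε : ℝ≥0∞) ≤ p.radius} (zero_lt_one (α := ℝ))
  refine ⟨_, (PolarSpace.isBounded_le_radius (by exact_mod_cast hε)).thickening (δ := r),
    Metric.isOpen_thickening.measurableSet, hr', fun p hp t => ?_⟩
  by_contra hlt
  refine hp (Metric.self_subset_thickening hr.1 _ (le_trans ?_ (p.toCPlus_le_radius t)))
  exact_mod_cast (not_le.1 hlt).le

/-- A countable partition of the points with finite radius into continuity sets on which the
represented functions are almost constant. -/
theorem exists_cells (ν : Measure (PolarSpace T)) [SFinite ν] {δ : ℝ} (hδ : 0 < δ) :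
    ∃ (A : ℕ → Set (PolarSpace T)) (g : ℕ → CPlus T),
      (∀ l, MeasurableSet (A l) ∧ ν (frontier (A l)) = 0) ∧
      Pairwise (Function.onFun Disjoint A) ∧
      (∀ l, ∀ p ∈ A l, dist p.toCPlus (g l) ≤ δ) ∧ (⋃ l, A l) = {p | p.radius ≠ ∞} := by
  set R : Set (PolarSpace T) := {p | p.radius ≠ ∞} with hR
  -- The case of empty `T` is included here; the enumeration by `ℕ` below needs a nonempty cover.
  rcases R.eq_empty_or_nonempty with hemp | hne
  · refine ⟨fun _ => ∅, fun _ => 0, fun l => ⟨MeasurableSet.empty, by simp⟩,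
      fun i j _ => Set.disjoint_empty _, by simp, by simp [hemp]⟩
  have hball : ∀ p ∈ R, ∃ U : Set (PolarSpace T), U ∈ 𝓝 p ∧ MeasurableSet U ∧
      ν (frontier U) = 0 ∧ U ⊆ R ∧ ∀ q ∈ U, dist q.toCPlus p.toCPlus ≤ δ := by
    intro p hp
    have h1 : ∀ᶠ q in 𝓝 p, dist q.toCPlus p.toCPlus < δ :=
      Metric.tendsto_nhds.1 (PolarSpace.continuousAt_toCPlus hp) δ hδ
    have h2 : ∀ᶠ q in 𝓝 p, q ∈ R := PolarSpace.isOpen_radius_ne_top.mem_nhds hp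
    obtain ⟨s, hs, hs'⟩ := Metric.eventually_nhds_iff_ball.1 (h1.and h2)
    obtain ⟨r, hr, hr'⟩ := exists_null_frontier_thickening ν {p} hs
    rw [Metric.thickening_singleton] at hr'
    have hsub := Metric.ball_subset_ball (x := p) hr.2.le
    exact ⟨Metric.ball p r, Metric.ball_mem_nhds p hr.1, Metric.isOpen_ball.measurableSet, hr',
      fun q hq => (hs' q (hsub hq)).2, fun q hq => (hs' q (hsub hq)).1.le⟩
  choose! U hU hUm hUf hUR hUd using hball
  -- Lindelöf: second countability reduces the balls to countably many. Making them disjoint keeps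
  -- null frontiers, since only finite intersections and complements are involved.
  obtain ⟨t, htR, htc, ht⟩ := TopologicalSpace.countable_cover_nhdsWithin
    (fun p hp => mem_nhdsWithin_of_mem_nhds (hU p hp))
  have htne : t.Nonempty := by
    obtain ⟨p, hp⟩ := hne
    obtain ⟨q, hq, _⟩ := Set.mem_iUnion₂.1 (ht hp)
    exact ⟨q, hq⟩
  obtain ⟨e, rfl⟩ := htc.exists_eq_range htne
  have heR : ∀ l, e l ∈ R := fun l => htR ⟨l, rfl⟩
  refine ⟨disjointed fun l => U (e l), fun l => (e l).toCPlus, fun l => ?_, disjoint_disjointed _,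
    fun l p hp => hUd _ (heR l) p (disjointed_le (fun l => U (e l)) l hp), ?_⟩
  · refine disjointedRec (f := fun l => U (e l))
      (p := fun S => MeasurableSet S ∧ ν (frontier S) = 0) ?_ ⟨hUm _ (heR l), hUf _ (heR l)⟩
    rintro S l ⟨h1, h2⟩
    refine ⟨h1.diff (hUm _ (heR l)), ?_⟩
    rw [Set.sdiff_eq]
    refine null_frontier_inter h2 ?_
    rw [frontier_compl]
    exact hUf _ (heR l)
  · rw [iUnion_disjointed]
    refine Set.Subset.antisymm (Set.iUnion_subset fun l => hUR _ (heR l)) fun p hp => ?_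
    obtain ⟨q, ⟨l, rfl⟩, hq⟩ := Set.mem_iUnion₂.1 (ht hp)
    exact Set.mem_iUnion.2 ⟨l, hq⟩

end Polar


/-! ### Block events of an i.i.d. sequence -/

section Blocks

variable {Ω α : Type*} [mΩ : MeasurableSpace Ω] [mα : MeasurableSpace α] {P : Measure Ω}

/-- Among the `X i`, `i ∈ J`, none is in `S` if `o = none`, and exactly one of them is in `S`, and
this one is in `C`, if `o = some C`. -/
def blockEvent (X : ℕ → Ω → α) (S : Set α) (J : Finset ℕ) : Option (Set α) → Set Ω
  | none => {ω | ∀ i ∈ J, X i ω ∉ S}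
  | some C => {ω | ∃ i ∈ J, X i ω ∈ C ∧ ∀ i' ∈ J, i' ≠ i → X i' ω ∉ S}

theorem blockEvent_none (X : ℕ → Ω → α) (S : Set α) (J : Finset ℕ) :
    blockEvent X S J none = ⋂ i ∈ J, X i ⁻¹' Sᶜ := by
  ext ω
  simp [blockEvent]

theorem blockEvent_some (X : ℕ → Ω → α) (S C : Set α) (J : Finset ℕ) :
    blockEvent X S J (some C) = ⋃ i ∈ J, ⋂ i' ∈ J, X i' ⁻¹' (if i' = i then C else Sᶜ) := by
  ext ω
  simp only [blockEvent, Set.mem_ofPred_eq, Set.mem_iUnion, Set.mem_iInter, Set.mem_preimage]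
  constructor
  · rintro ⟨i, hi, hC, hS⟩
    refine ⟨i, hi, fun i' hi' => ?_⟩
    by_cases h : i' = i
    · rw [if_pos h, h]
      exact hC
    · rw [if_neg h]
      exact hS i' hi' h
  · rintro ⟨i, hi, h⟩
    refine ⟨i, hi, ?_, fun i' hi' hne => ?_⟩
    · simpa using h i hi
    · have := h i' hi'
      rw [if_neg hne] at this
      exact this

/-- Measurability with respect to the coordinates in `K` alone is what makes events of disjoint
blocks independent. -/
theorem measurableSet_iSup_comap_blockEvent (X : ℕ → Ω → α) {S : Set α} (hS : MeasurableSet S)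
    {o : Option (Set α)} (ho : ∀ C ∈ o, MeasurableSet C) {J : Finset ℕ} {K : Set ℕ}
    (hJK : ∀ i ∈ J, i ∈ K) :
    MeasurableSet[⨆ i ∈ K, mα.comap (X i)] (blockEvent X S J o) := by
  have key : ∀ i ∈ J, ∀ D : Set α, MeasurableSet D →
      MeasurableSet[⨆ i ∈ K, mα.comap (X i)] (X i ⁻¹' D) := by
    intro i hi D hD
    have hle : mα.comap (X i) ≤ ⨆ i ∈ K, mα.comap (X i) :=
      le_iSup₂ (f := fun i (_ : i ∈ K) => mα.comap (X i)) i (hJK i hi)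
    exact hle _ ⟨D, hD, rfl⟩
  rcases o with _ | C
  · rw [blockEvent_none]
    exact Finset.measurableSet_biInter _ fun i hi => key i hi _ hS.compl
  · rw [blockEvent_some]
    refine Finset.measurableSet_biUnion _ fun i hi => Finset.measurableSet_biInter _ fun i' hi' =>
      key i' hi' _ ?_
    split_ifs
    · exact ho C rfl
    · exact hS.compl

theorem iSup_comap_le {X : ℕ → Ω → α} (hX : ∀ i, Measurable (X i)) (K : Set ℕ) :
    ⨆ i ∈ K, mα.comap (X i) ≤ mΩ :=
  iSup₂_le fun i _ => (hX i).comap_le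

theorem measurableSet_blockEvent {X : ℕ → Ω → α} (hX : ∀ i, Measurable (X i)) {S : Set α}
    (hS : MeasurableSet S) {o : Option (Set α)} (ho : ∀ C ∈ o, MeasurableSet C) (J : Finset ℕ) :
    MeasurableSet (blockEvent X S J o) :=
  iSup_comap_le hX Set.univ _
    (measurableSet_iSup_comap_blockEvent X hS ho (fun i _ => Set.mem_univ i))

theorem disjoint_blockEvent {X : ℕ → Ω → α} {S : Set α} {J : Finset ℕ} {o o' : Option (Set α)}
    (ho : ∀ C ∈ o, C ⊆ S) (ho' : ∀ C ∈ o', C ⊆ S) (h : ∀ C ∈ o, ∀ C' ∈ o', Disjoint C C')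
    (hoo : o.isSome ∨ o'.isSome) :
    Disjoint (blockEvent X S J o) (blockEvent X S J o') := by
  rw [Set.disjoint_left]
  intro ω h1 h2
  rcases o with _ | C <;> rcases o' with _ | C'
  · simp at hoo
  · obtain ⟨i, hi, hC, -⟩ := h2
    exact h1 i hi (ho' C' rfl hC)
  · obtain ⟨i, hi, hC, -⟩ := h1
    exact h2 i hi (ho C rfl hC)
  · obtain ⟨i, hi, hC, h1⟩ := h1
    obtain ⟨i', hi', hC', h2⟩ := h2
    rcases eq_or_ne i i' with rfl | hne
    · exact Set.disjoint_left.1 (h C rfl C' rfl) hC hC'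
    · exact h1 i' hi' hne.symm (ho' C' rfl hC')

/-- An event with one point splits disjointly according to the index of that point, each piece being
a rectangle for the independent variables; disjointness uses `C ⊆ S`. -/
theorem measureReal_blockEvent [IsProbabilityMeasure P] {X : ℕ → Ω → α}
    (hX : ∀ i, Measurable (X i)) (hind : iIndepFun X P)
    (hid : ∀ i, IdentDistrib (X i) (X 0) P P) {S : Set α} (hS : MeasurableSet S)
    (J : Finset ℕ) (o : Option (Set α)) (ho : ∀ C ∈ o, MeasurableSet C ∧ C ⊆ S) :
    P.real (blockEvent X S J o) = match o with
      | none => (1 - P.real (X 0 ⁻¹' S)) ^ J.card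
      | some C => J.card * P.real (X 0 ⁻¹' C) * (1 - P.real (X 0 ⁻¹' S)) ^ (J.card - 1) := by
  have hcompl : P.real (X 0 ⁻¹' Sᶜ) = 1 - P.real (X 0 ⁻¹' S) := by
    rw [Set.preimage_compl, probReal_compl_eq_one_sub (hX 0 hS)]
  have hreal : ∀ i (D : Set α), MeasurableSet D → P.real (X i ⁻¹' D) = P.real (X 0 ⁻¹' D) := by
    intro i D hD
    rw [measureReal_def, measureReal_def, (hid i).measure_preimage_eq hD]
  have hprod : ∀ D : ℕ → Set α, (∀ i, MeasurableSet (D i)) →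
      P.real (⋂ i ∈ J, X i ⁻¹' D i) = ∏ i ∈ J, P.real (X 0 ⁻¹' D i) := by
    intro D hD
    rw [measureReal_def, hind.measure_inter_preimage_eq_mul J (fun i _ => hD i),
      ENNReal.toReal_prod]
    exact Finset.prod_congr rfl fun i _ => hreal i _ (hD i)
  rcases o with _ | C
  · rw [blockEvent_none, hprod _ fun _ => hS.compl, Finset.prod_const, hcompl]
  · obtain ⟨hC, hCS⟩ := ho C rfl
    have hm : ∀ i i' : ℕ, MeasurableSet (if i' = i then C else Sᶜ) := by
      intro i i'
      split_ifs
      exacts [hC, hS.compl]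
    rw [blockEvent_some, measureReal_biUnion_finset]
    · have : ∀ i ∈ J, P.real (⋂ i' ∈ J, X i' ⁻¹' (if i' = i then C else Sᶜ)) =
          P.real (X 0 ⁻¹' C) * (1 - P.real (X 0 ⁻¹' S)) ^ (J.card - 1) := by
        intro i hi
        rw [hprod _ (hm i), ← Finset.mul_prod_erase J _ hi, if_pos rfl, ← hcompl,
          ← Finset.card_erase_of_mem hi, ← Finset.prod_const]
        congr 1
        refine Finset.prod_congr rfl fun i' hi' => ?_
        rw [if_neg (Finset.ne_of_mem_erase hi')]
      rw [Finset.sum_congr rfl this, Finset.sum_const, nsmul_eq_mul]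
      ring
    · intro i hi i' hi' hne
      rw [Function.onFun, Set.disjoint_left]
      intro ω h1 h2
      rw [Set.mem_iInter₂] at h1 h2
      have h3 := h1 i hi
      have h4 := h2 i hi
      simp only [if_true, if_neg hne, Set.mem_preimage] at h3 h4
      exact h4 (hCS h3)
    · intro i _
      exact Finset.measurableSet_biInter _ fun i' _ => hX i' (hm i i')

/-- The first `m` blocks use indices below `k m`, the next one indices from `k m` on. -/
theorem measureReal_iInter_blockEvent [IsProbabilityMeasure P] {X : ℕ → Ω → α}
    (hX : ∀ i, Measurable (X i)) (hind : iIndepFun X P) {S : Set α} (hS : MeasurableSet S)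
    {k : ℕ → ℕ} (hk : Monotone k) (o : ℕ → Option (Set α)) (ho : ∀ b, ∀ C ∈ o b, MeasurableSet C)
    (m : ℕ) :
    P.real (⋂ b ∈ Finset.range m, blockEvent X S (Finset.Ico (k b) (k (b + 1))) (o b)) =
      ∏ b ∈ Finset.range m, P.real (blockEvent X S (Finset.Ico (k b) (k (b + 1))) (o b)) := by
  induction m with
  | zero => simp
  | succ m ih =>
    rw [Finset.prod_range_succ, ← ih, Finset.range_add_one, Finset.set_biInter_insert,
      Set.inter_comm]
    have hindep : Indep (⨆ i ∈ Set.Iio (k m), mα.comap (X i)) (⨆ i ∈ Set.Ici (k m), mα.comap (X i))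
        P := by
      refine indep_iSup_of_disjoint (fun i => (hX i).comap_le) hind.iIndep ?_
      exact Set.disjoint_left.2 fun i h1 h2 => absurd (Set.mem_Ici.1 h2) (not_le.2 h1)
    have h1 : MeasurableSet[⨆ i ∈ Set.Iio (k m), mα.comap (X i)]
        (⋂ b ∈ Finset.range m, blockEvent X S (Finset.Ico (k b) (k (b + 1))) (o b)) := by
      refine Finset.measurableSet_biInter _ fun b hb => ?_
      refine measurableSet_iSup_comap_blockEvent X hS (ho b) fun i hi => ?_
      exact (Finset.mem_Ico.1 hi).2.trans_le (hk (Finset.mem_range.1 hb))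
    have h2 : MeasurableSet[⨆ i ∈ Set.Ici (k m), mα.comap (X i)]
        (blockEvent X S (Finset.Ico (k m) (k (m + 1))) (o m)) :=
      measurableSet_iSup_comap_blockEvent X hS (ho m) fun i hi => (Finset.mem_Ico.1 hi).1
    rw [measureReal_def, (Indep_iff _ _ _).1 hindep _ _ h1 h2, ENNReal.toReal_mul]
    rfl

end Blocks

/-! ### Limits of block probabilities -/

section BlockLimits

/-- Write the power as `((1 - p n) ^ n) ^ (k n / n)`; the base tends to `exp (-lam)` and the
exponent to `h`. -/
theorem tendsto_one_sub_pow {p : ℕ → ℝ} {k : ℕ → ℕ} {lam h : ℝ} (hp : ∀ n, p n ≤ 1)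
    (hlim : Tendsto (fun n : ℕ => n * p n) atTop (𝓝 lam))
    (hk : Tendsto (fun n : ℕ => (k n : ℝ) / n) atTop (𝓝 h)) :
    Tendsto (fun n => (1 - p n) ^ k n) atTop (𝓝 (Real.exp (-(h * lam)))) := by
  have h1 : Tendsto (fun n : ℕ => (1 + -p n) ^ n) atTop (𝓝 (Real.exp (-lam))) := by
    refine Real.tendsto_one_add_pow_exp_of_tendsto ?_
    simpa using hlim.neg
  have h2 := h1.rpow hk (Or.inl (Real.exp_pos _).ne')
  rw [← Real.exp_mul, show -lam * h = -(h * lam) by ring] at h2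
  refine h2.congr' ?_
  filter_upwards [eventually_ne_atTop 0] with n hn
  have hnn : 0 ≤ 1 + -p n := by linarith [hp n]
  rw [← Real.rpow_natCast, ← Real.rpow_mul hnn, mul_div_cancel₀ _ (by exact_mod_cast hn),
    Real.rpow_natCast, sub_eq_add_neg]

theorem tendsto_pred_div {k : ℕ → ℕ} {h : ℝ}
    (hk : Tendsto (fun n : ℕ => (k n : ℝ) / n) atTop (𝓝 h)) :
    Tendsto (fun n : ℕ => ((k n - 1 : ℕ) : ℝ) / n) atTop (𝓝 h) := by
  have h1 : Tendsto (fun n : ℕ => (k n : ℝ) / n - 1 / n) atTop (𝓝 h) := by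
    simpa using hk.sub tendsto_one_div_atTop_nhds_zero_nat
  refine tendsto_of_tendsto_of_tendsto_of_le_of_le h1 hk (fun n => ?_) (fun n => ?_)
  · dsimp only
    rw [← sub_div]
    gcongr
    have : k n ≤ (k n - 1) + 1 := by omega
    have : (k n : ℝ) ≤ ((k n - 1 : ℕ) : ℝ) + 1 := by exact_mod_cast this
    linarith
  · dsimp only
    gcongr
    omega

theorem tendsto_mul_one_sub_pow {p c : ℕ → ℝ} {k : ℕ → ℕ} {lam h c' : ℝ} (hp : ∀ n, p n ≤ 1)
    (hlim : Tendsto (fun n : ℕ => n * p n) atTop (𝓝 lam))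
    (hc : Tendsto (fun n : ℕ => n * c n) atTop (𝓝 c'))
    (hk : Tendsto (fun n : ℕ => (k n : ℝ) / n) atTop (𝓝 h)) :
    Tendsto (fun n => k n * c n * (1 - p n) ^ (k n - 1)) atTop
      (𝓝 (h * c' * Real.exp (-(h * lam)))) := by
  refine Tendsto.mul ?_ (tendsto_one_sub_pow hp hlim (tendsto_pred_div hk))
  refine (hk.mul hc).congr' ?_
  filter_upwards [eventually_ne_atTop 0] with n hn
  have : (n : ℝ) ≠ 0 := by exact_mod_cast hn
  field_simp

theorem tendsto_card_block (h : ℝ≥0) (b : ℕ) :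
    Tendsto (fun n : ℕ => ((Finset.Ico ⌊(n : ℝ≥0) * (b * h)⌋₊
      ⌊(n : ℝ≥0) * (((b + 1 : ℕ) : ℝ≥0) * h)⌋₊).card : ℝ) / n) atTop (𝓝 h) := by
  have key : ∀ b : ℕ, Tendsto (fun n : ℕ => (⌊(n : ℝ≥0) * (b * h)⌋₊ : ℝ) / n) atTop
      (𝓝 (b * h)) := by
    intro b
    have h1 := (tendsto_nat_floor_mul_div_atTop (R := ℝ) (a := b * h) (by positivity)).comp
      tendsto_natCast_atTop_atTop
    refine h1.congr fun n => ?_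
    have e : ⌊(n : ℝ≥0) * (b * h)⌋₊ = ⌊(((n : ℝ≥0) * (b * h) : ℝ≥0) : ℝ)⌋₊ :=
      (Nonneg.nat_floor_coe _).symm
    rw [Function.comp_apply, e]
    congr 3
    push_cast
    ring
  have h2 := (key (b + 1)).sub (key b)
  have e : ((b + 1 : ℕ) : ℝ) * h - b * h = h := by push_cast; ring
  rw [e] at h2
  refine h2.congr fun n => ?_
  rw [Nat.card_Ico, Nat.cast_sub, sub_div]
  refine Nat.floor_mono ?_
  gcongr
  omega

end BlockLimits

/-! ### Block events of the triangular array -/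

section Array

variable {T : Type*} [MetricSpace T] [CompactSpace T]

theorem le_of_notMem_polarPreimage {S : Set (PolarSpace T)} {ε : ℝ≥0}
    (hS : ∀ p ∉ S, ∀ t, p.toCPlus t ≤ ε) {x : CPlus T} (hx : x ∉ polarPreimage S) (t : T) :
    x t ≤ ε := by
  rcases eq_or_ne x 0 with rfl | h0
  · exact zero_le
  · rw [mem_polarPreimage] at hx
    have := hS (polar ⟨x, h0⟩) (fun h => hx ⟨h0, h⟩) t
    rwa [toCPlus_polar] at this

theorem disjoint_polarPreimage {S S' : Set (PolarSpace T)} (h : Disjoint S S') :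
    Disjoint (polarPreimage S) (polarPreimage S') := by
  rw [Set.disjoint_left]
  intro x h1 h2
  obtain ⟨h0, h1⟩ := mem_polarPreimage.1 h1
  obtain ⟨_, h2⟩ := mem_polarPreimage.1 h2
  exact Set.disjoint_left.1 h h1 h2

theorem polarPreimage_mono {S S' : Set (PolarSpace T)} (h : S ⊆ S') :
    polarPreimage S ⊆ polarPreimage S' := fun _ hx =>
  mem_polarPreimage.2 ((mem_polarPreimage.1 hx).imp fun _ h' => h h')

/-- Indices start at `0` and marks at `1/n`, so an index block closed on the left corresponds to a
time cell closed on the right. -/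
theorem mem_block_iff {n : ℕ} (hn : n ≠ 0) {h : ℝ≥0} {b i : ℕ} :
    i ∈ Finset.Ico ⌊(n : ℝ≥0) * (b * h)⌋₊ ⌊(n : ℝ≥0) * (((b + 1 : ℕ) : ℝ≥0) * h)⌋₊ ↔
      ((i : ℝ≥0) + 1) / n ∈ Set.Ioc (b * h) ((b + 1) * h) := by
  rw [Finset.mem_Ico, Set.mem_Ioc, ← not_lt, ← div_le_iff_lt_floor hn, not_le,
    ← div_le_iff_lt_floor hn]
  push_cast
  rfl

theorem arrayPath_patternPath_mem_entourage {n : ℕ} (hn : n ≠ 0) {Ω : Type*} {X : ℕ → Ω → CPlus T}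
    {ω : Ω} {m L : ℕ} {h ε a : ℝ≥0} (hh : 0 < h) (hirr : Irrational h) (ha : a ≤ m * h)
    {S : Set (PolarSpace T)} (hS : ∀ p ∉ S, ∀ t, p.toCPlus t ≤ ε)
    {A : Fin L → Set (PolarSpace T)} {g : Fin L → CPlus T}
    (hA : ∀ l, ∀ p ∈ A l, dist p.toCPlus (g l) ≤ ε) (q : Fin m → Option (Fin L))
    (hω : ∀ b : Fin m, ω ∈ blockEvent X (polarPreimage S)
      (Finset.Ico ⌊(n : ℝ≥0) * ((b : ℕ) * h)⌋₊ ⌊(n : ℝ≥0) * ((((b : ℕ) + 1 : ℕ) : ℝ≥0) * h)⌋₊)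
      ((q b).map fun l => polarPreimage (A l))) (r : ℕ) :
    (arrayPath n r (fun i => X i ω), patternPath (fun b => (q b).map g) h r) ∈
      SkorokhodSpace.entourage (Fin r → CPlus T) a (max ε h) := by
  refine orderPath_patternPath_mem_entourage _ hh ha ?_ ?_ ?_ r
  · intro i hi
    rw [div_eq_zero_iff] at hi
    rcases hi with hi | hi
    · exact absurd hi (by positivity)
    · exact absurd (by exact_mod_cast hi) hn
  · intro b hb i hi t
    rw [Option.map_eq_none_iff] at hb
    have := hω b
    rw [hb] at this
    rw [if_neg hn]
    exact le_of_notMem_polarPreimage hS (this i ((mem_block_iff hn).2 hi)) t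
  · intro b g' hb
    obtain ⟨l, hl, rfl⟩ := Option.map_eq_some_iff.1 hb
    have := hω b
    rw [hl] at this
    obtain ⟨i, hi, hC, hne⟩ := this
    have hi' := (mem_block_iff hn).1 hi
    refine ⟨i, ⟨hi'.1, lt_of_le_of_ne hi'.2 fun he => ?_⟩, ?_, fun i' hi'' hne' t => ?_⟩
    -- A mark on the grid would give `(i+1)/n = (b+1)h`, which irrationality of `h` excludes.
    · refine (irrational_iff_ne_rational (h : ℝ)).1 hirr (i + 1) (n * ((b : ℕ) + 1))
        (by exact_mod_cast (by positivity : n * ((b : ℕ) + 1) ≠ 0)) ?_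
      rw [← NNReal.coe_inj] at he
      push_cast at he ⊢
      have hn' : (n : ℝ) ≠ 0 := by exact_mod_cast hn
      rw [div_eq_iff hn'] at he
      rw [he]
      field_simp
    · rw [if_neg hn]
      obtain ⟨h0, hp⟩ := mem_polarPreimage.1 hC
      have := hA l _ hp
      rwa [toCPlus_polar] at this
    · rw [if_neg hn]
      exact le_of_notMem_polarPreimage hS (hne i' ((mem_block_iff hn).2 hi'') hne') t

end Array


/-! ### Block events of a Poisson process -/

/-! ### Lebesgue measure on the half-line. -/

section LebesgueHalfLine

theorem lebesgueHalfLine_apply (S : Set ℝ≥0) :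
    lebesgueHalfLine S = volume ((↑) '' S : Set ℝ) :=
  NNReal.isClosedEmbedding_coe.measurableEmbedding.comap_apply _ _

theorem lebesgueHalfLine_Ioc (a b : ℝ≥0) :
    lebesgueHalfLine (Set.Ioc a b) = ENNReal.ofReal (b - a) := by
  rw [lebesgueHalfLine_apply, ← Real.volume_Ioc]
  congr 1
  ext x
  constructor
  · rintro ⟨y, ⟨h1, h2⟩, rfl⟩
    exact ⟨by exact_mod_cast h1, by exact_mod_cast h2⟩
  · rintro ⟨h1, h2⟩
    exact ⟨⟨x, a.2.trans h1.le⟩, ⟨h1, h2⟩, rfl⟩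

theorem lebesgueHalfLine_Ioc_grid (b : ℕ) (h : ℝ≥0) :
    lebesgueHalfLine (Set.Ioc (b * h) ((b + 1) * h)) = h := by
  rw [lebesgueHalfLine_Ioc, ← ENNReal.ofReal_coe_nnreal]
  congr 1
  push_cast
  ring

theorem lebesgueHalfLine_countable {S : Set ℝ≥0} (hS : S.Countable) : lebesgueHalfLine S = 0 := by
  rw [lebesgueHalfLine_apply]
  exact (hS.image _).measure_zero _

instance : SigmaFinite lebesgueHalfLine := by
  have : IsLocallyFiniteMeasure lebesgueHalfLine := by
    refine ⟨fun x => ⟨Set.Iio (x + 1), Iio_mem_nhds (lt_add_one x), ?_⟩⟩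
    have hsub : Set.Iio (x + 1) ⊆ {0} ∪ Set.Ioc 0 (x + 1) := by
      intro y hy
      rcases eq_zero_or_pos y with h0 | h0
      · exact Or.inl h0
      · exact Or.inr ⟨h0, le_of_lt hy⟩
    refine (measure_mono hsub).trans_lt ((measure_union_le _ _).trans_lt ?_)
    rw [lebesgueHalfLine_countable (Set.countable_singleton 0), lebesgueHalfLine_Ioc, zero_add]
    exact ENNReal.ofReal_lt_top
  infer_instance

end LebesgueHalfLine

/-! ### Laws and independence of Poisson counts. -/

section PoissonProcess

variable {Ω E : Type*} [MeasurableSpace Ω] [PseudoMetricSpace E] [MeasurableSpace E]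
  {N : Ω → Measure E} {μ : Measure E} {P : Measure Ω}

theorem IsPoissonPointProcess.measurableSet_eq (hN : IsPoissonPointProcess N μ P) {S : Set E}
    (hS : MeasurableSet S) (c : ℝ≥0∞) : MeasurableSet {ω | N ω S = c} :=
  (Measure.measurable_coe hS).comp hN.measurable (measurableSet_singleton c)

theorem IsPoissonPointProcess.measureReal_eq (hN : IsPoissonPointProcess N μ P) {S : Set E}
    (hS : MeasurableSet S) (hμS : μ S ≠ ∞) (k : ℕ) :
    P.real {ω | N ω S = k} = Real.exp (-μ.real S) * μ.real S ^ k / k.factorial := by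
  have hm : Measurable fun ω => N ω S := (Measure.measurable_coe hS).comp hN.measurable
  have h1 : P {ω | N ω S = k} = P.map (fun ω => N ω S) {(k : ℝ≥0∞)} := by
    rw [Measure.map_apply hm (measurableSet_singleton _)]
    rfl
  rw [measureReal_def, h1, hN.law S hS hμS, Measure.map_apply (by fun_prop)
    (measurableSet_singleton _)]
  have h2 : (Nat.cast : ℕ → ℝ≥0∞) ⁻¹' {(k : ℝ≥0∞)} = {k} := by
    ext j
    simp
  rw [h2, ← measureReal_def, poissonMeasure_real_singleton]
  rfl

theorem IsPoissonPointProcess.ae_eq_zero [IsProbabilityMeasure P]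
    (hN : IsPoissonPointProcess N μ P) {S : Set E}
    (hS : MeasurableSet S) (hμS : μ S = 0) : ∀ᵐ ω ∂P, N ω S = 0 := by
  have h := hN.measureReal_eq hS (by simp [hμS]) 0
  simp only [measureReal_def μ, hμS, ENNReal.toReal_zero, neg_zero, Real.exp_zero, pow_zero,
    mul_one, Nat.factorial_zero, Nat.cast_one, div_one, Nat.cast_zero] at h
  have h1 : P {ω | N ω S = 0} = 1 := by
    rw [← ENNReal.toReal_eq_one_iff]
    exact h
  exact (mem_ae_iff_prob_eq_one (hN.measurableSet_eq hS 0)).2 h1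

theorem IsPoissonPointProcess.iIndepFun_of_fintype (hN : IsPoissonPointProcess N μ P)
    {κ : Type*} [Fintype κ] {A : κ → Set E} (hA : ∀ i, MeasurableSet (A i))
    (hd : Pairwise (Function.onFun Disjoint A)) : iIndepFun (fun i ω => N ω (A i)) P := by
  let e := Fintype.equivFin κ
  have h := hN.indep _ (fun i => A (e.symm i)) (fun i => hA _)
    (hd.comp_of_injective e.symm.injective)
  have h' := h.precomp e.injective
  refine h'.congr fun i => ae_of_all _ fun ω => ?_
  simp

/-- The process has no point in `S × J` if `o = none`, and exactly one point in `S × J`, which lies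
in `C × J`, if `o = some C`. -/
def poissonBlockEvent {F : Type*} [MeasurableSpace F] (N : Ω → Measure (F × ℝ≥0)) (S : Set F)
    (J : Set ℝ≥0) (o : Option (Set F)) : Set Ω :=
  {ω | N ω (o.getD ∅ ×ˢ J) = ((if o.isSome then 1 else 0 : ℕ) : ℝ≥0∞)} ∩
    {ω | N ω ((S \ o.getD ∅) ×ˢ J) = ((0 : ℕ) : ℝ≥0∞)}

end PoissonProcess

section PoissonBlocks

variable {Ω F : Type*} [MeasurableSpace Ω] [PseudoMetricSpace F] [MeasurableSpace F]
  {N : Ω → Measure (F × ℝ≥0)} {ν : Measure F} {P : Measure Ω}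

theorem measurableSet_getD {o : Option (Set F)} (ho : ∀ C ∈ o, MeasurableSet C) :
    MeasurableSet (o.getD ∅) := by
  rcases o with _ | C
  · exact MeasurableSet.empty
  · exact ho C rfl

theorem IsPoissonPointProcess.measurableSet_poissonBlockEvent {μ : Measure (F × ℝ≥0)}
    (hN : IsPoissonPointProcess N μ P) {S : Set F} (hS : MeasurableSet S) {J : Set ℝ≥0}
    (hJ : MeasurableSet J) {o : Option (Set F)} (ho : ∀ C ∈ o, MeasurableSet C) :
    MeasurableSet (poissonBlockEvent N S J o) :=
  (hN.measurableSet_eq ((measurableSet_getD ho).prod hJ) _).inter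
    (hN.measurableSet_eq ((hS.diff (measurableSet_getD ho)).prod hJ) _)

theorem disjoint_poissonBlockEvent {S : Set F} {J : Set ℝ≥0}
    {o o' : Option (Set F)} (ho : ∀ C ∈ o, C ⊆ S) (ho' : ∀ C ∈ o', C ⊆ S)
    (h : ∀ C ∈ o, ∀ C' ∈ o', Disjoint C C') (hoo : o.isSome ∨ o'.isSome) :
    Disjoint (poissonBlockEvent N S J o) (poissonBlockEvent N S J o') := by
  have key : ∀ (ω : Ω) (C : Set F) (o' : Option (Set F)), C ⊆ S → (∀ C' ∈ o', Disjoint C C') →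
      ω ∈ poissonBlockEvent N S J (some C) → ω ∈ poissonBlockEvent N S J o' → False := by
    rintro ω C o' hC h ⟨h1, -⟩ ⟨-, h2⟩
    -- The point counted in `C × J` would lie in the region that the other event requires to be
    -- empty.
    have hsub : C ×ˢ J ⊆ (S \ o'.getD ∅) ×ˢ J := by
      refine Set.prod_mono (fun x hx => ⟨hC hx, fun hx' => ?_⟩) subset_rfl
      rcases o' with _ | C'
      · exact hx'
      · exact Set.disjoint_left.1 (h C' rfl) hx hx'
    have h3 := measure_mono (μ := N ω) hsub
    have h1 : N ω (C ×ˢ J) = ((1 : ℕ) : ℝ≥0∞) := h1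
    have h2 : N ω ((S \ o'.getD ∅) ×ˢ J) = ((0 : ℕ) : ℝ≥0∞) := h2
    rw [h1, h2] at h3
    simp at h3
  rw [Set.disjoint_left]
  intro ω h1 h2
  rcases o with _ | C
  · rcases o' with _ | C'
    · simp at hoo
    · exact key ω C' none (ho' C' rfl) (by simp) h2 h1
  · exact key ω C o' (ho C rfl) (h C rfl) h1 h2

/-- The limiting probability of a block event. -/
def blockLimit (ν : Measure F) (S : Set F) (h : ℝ) : Option (Set F) → ℝ
  | none => Real.exp (-(h * ν.real S))
  | some C => h * ν.real C * Real.exp (-(h * ν.real S))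

/-- The `2m` sets formed by the chosen part of `S` and its remainder, over each time cell, are
disjoint, so their counts are independent Poisson variables. In each cell the two exponentials
combine to `exp (-(h * ν.real S))`. -/
theorem IsPoissonPointProcess.measureReal_iInter_poissonBlockEvent [IsProbabilityMeasure P]
    (hN : IsPoissonPointProcess N (ν.prod lebesgueHalfLine) P) {S : Set F} (hS : MeasurableSet S)
    (hνS : ν S ≠ ∞) (h : ℝ≥0) {m : ℕ} (o : Fin m → Option (Set F))
    (ho : ∀ b, ∀ C ∈ o b, MeasurableSet C ∧ C ⊆ S) :
    P.real (⋂ b : Fin m, poissonBlockEvent N S (Set.Ioc ((b : ℕ) * h) (((b : ℕ) + 1) * h)) (o b)) =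
      ∏ b, blockLimit ν S h (o b) := by
  let J : Fin m → Set ℝ≥0 := fun b => Set.Ioc ((b : ℕ) * h) (((b : ℕ) + 1) * h)
  have hJ : ∀ b, MeasurableSet (J b) := fun b => measurableSet_Ioc
  let A : Fin m × Bool → Set (F × ℝ≥0) := fun z =>
    (if z.2 then (o z.1).getD ∅ else S \ (o z.1).getD ∅) ×ˢ J z.1
  let c : Fin m × Bool → ℕ := fun z => if z.2 then (if (o z.1).isSome then 1 else 0) else 0
  have hC : ∀ b, MeasurableSet ((o b).getD ∅) := fun b => measurableSet_getD fun C hC => (ho b C hC).1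
  have hCS : ∀ b, (o b).getD ∅ ⊆ S := by
    intro b
    rcases hb : o b with _ | C
    · exact Set.empty_subset _
    · exact (ho b C hb).2
  have hA : ∀ z, MeasurableSet (A z) := by
    rintro ⟨b, z⟩
    refine MeasurableSet.prod ?_ (hJ b)
    rcases z with _ | _
    · exact hS.diff (hC b)
    · exact hC b
  have hd : Pairwise (Function.onFun Disjoint A) := by
    rintro ⟨b, z⟩ ⟨b', z'⟩ hne
    rw [Function.onFun, Set.disjoint_prod]
    rcases eq_or_ne b b' with rfl | hb
    · left
      rcases z with _ | _ <;> rcases z' with _ | _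
      · exact absurd rfl hne
      · exact Set.disjoint_sdiff_left
      · exact Set.disjoint_sdiff_right
      · exact absurd rfl hne
    · right
      exact Set.disjoint_left.2 fun u hu hu' => hb (Fin.ext (Ioc_grid_unique hu hu'))
  have hset : (⋂ b, poissonBlockEvent N S (J b) (o b)) =
      ⋂ z ∈ (Finset.univ : Finset (Fin m × Bool)), (fun ω => N ω (A z)) ⁻¹' {(c z : ℝ≥0∞)} := by
    ext ω
    simp only [Set.mem_iInter, Finset.mem_univ, true_imp_iff, Prod.forall]
    refine forall_congr' fun b => ?_
    rw [Bool.forall_bool, and_comm]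
    rfl
  have hAν : ∀ b z, (ν.prod lebesgueHalfLine).real (A (b, z)) =
      ν.real (if z then (o b).getD ∅ else S \ (o b).getD ∅) * h := by
    intro b z
    rw [measureReal_def, Measure.prod_prod, lebesgueHalfLine_Ioc_grid, ENNReal.toReal_mul]
    rfl
  have hAtop : ∀ z, (ν.prod lebesgueHalfLine) (A z) ≠ ∞ := by
    rintro ⟨b, z⟩
    rw [Measure.prod_prod, lebesgueHalfLine_Ioc_grid]
    refine ENNReal.mul_ne_top (measure_ne_top_of_subset ?_ hνS) ENNReal.coe_ne_top
    rcases z with _ | _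
    · exact Set.sdiff_subset
    · exact hCS b
  change P.real (⋂ b, poissonBlockEvent N S (J b) (o b)) = _
  rw [hset, measureReal_def, (hN.iIndepFun_of_fintype hA hd).measure_inter_preimage_eq_mul _
    (fun z _ => measurableSet_singleton _), ENNReal.toReal_prod, Fintype.prod_prod_type]
  refine Finset.prod_congr rfl fun b _ => ?_
  have hz : ∀ z, (P ((fun ω => N ω (A z)) ⁻¹' {(c z : ℝ≥0∞)})).toReal =
      Real.exp (-(ν.prod lebesgueHalfLine).real (A z)) *
        (ν.prod lebesgueHalfLine).real (A z) ^ c z / (c z).factorial :=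
    fun z => hN.measureReal_eq (hA z) (hAtop z) (c z)
  rw [Fintype.prod_bool, hz, hz, hAν, hAν]
  have hdiff : ν.real (S \ (o b).getD ∅) = ν.real S - ν.real ((o b).getD ∅) :=
    measureReal_sdiff (hCS b) (hC b) hνS
  simp only [if_true, Bool.false_eq_true, if_false, c, pow_zero, mul_one, Nat.factorial_zero,
    Nat.cast_one, div_one, hdiff]
  rcases o b with _ | C
  · simp [blockLimit, mul_comm]
  · simp only [Option.getD_some, Option.isSome_some, if_true, pow_one, Nat.factorial_one,
      Nat.cast_one, div_one, blockLimit]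
    rw [mul_right_comm, ← Real.exp_add, mul_comm (h : ℝ) (ν.real C), mul_comm (Real.exp _)]
    congr 2
    ring

theorem IsPoissonPointProcess.measureReal_ne_zero_le [IsProbabilityMeasure P]
    {μ : Measure (F × ℝ≥0)} (hN : IsPoissonPointProcess N μ P) {A : Set (F × ℝ≥0)}
    (hA : MeasurableSet A) (hμA : μ A ≠ ∞) : P.real {ω | N ω A ≠ 0} ≤ μ.real A := by
  have h1 := hN.measureReal_eq hA hμA 0
  have h2 := hN.measurableSet_eq hA 0
  have e : {ω | N ω A ≠ 0} = {ω | N ω A = 0}ᶜ := rfl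
  rw [e, probReal_compl_eq_one_sub h2]
  simp only [Nat.cast_zero, pow_zero, mul_one, Nat.factorial_zero, Nat.cast_one, div_one] at h1
  rw [h1]
  have := Real.add_one_le_exp (-μ.real A)
  linarith

/-- From `exp (-x) ≥ 1 - x` follows `1 - (1 + x) exp (-x) ≤ 1 - (1 + x)(1 - x) = x²`. -/
theorem IsPoissonPointProcess.measureReal_ne_zero_one_le [IsProbabilityMeasure P]
    {μ : Measure (F × ℝ≥0)} (hN : IsPoissonPointProcess N μ P) {A : Set (F × ℝ≥0)}
    (hA : MeasurableSet A) (hμA : μ A ≠ ∞) :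
    P.real {ω | N ω A ≠ 0 ∧ N ω A ≠ 1} ≤ μ.real A ^ 2 := by
  have h0 := hN.measureReal_eq hA hμA 0
  have h1 := hN.measureReal_eq hA hμA 1
  have h0m := hN.measurableSet_eq hA 0
  have h1m := hN.measurableSet_eq hA 1
  have e : {ω | N ω A ≠ 0 ∧ N ω A ≠ 1} = ({ω | N ω A = 0} ∪ {ω | N ω A = 1})ᶜ := by
    ext ω
    simp
  simp only [Nat.cast_zero, pow_zero, mul_one, Nat.factorial_zero, Nat.cast_one, div_one, pow_one,
    Nat.factorial_one] at h0 h1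
  rw [e, probReal_compl_eq_one_sub (h0m.union h1m), measureReal_union _ h1m, h0, h1]
  · have h2 := Real.add_one_le_exp (-μ.real A)
    have h3 : 0 ≤ μ.real A := measureReal_nonneg
    nlinarith
  · rw [Set.disjoint_left]
    intro ω h2 h3
    have h2 : N ω A = 0 := h2
    have h3 : N ω A = 1 := h3
    rw [h2] at h3
    exact zero_ne_one h3

end PoissonBlocks

/-! ### Paths of a Poisson process -/

section PoissonPath

variable {T : Type*} [MetricSpace T] [CompactSpace T]

theorem sum_dirac_eq_zero_iff {ι E : Type*} [Countable ι] [MeasurableSpace E]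
    [MeasurableSingletonClass E] (x : ι → E) (S : Set E) :
    (Measure.sum fun i => Measure.dirac (x i)) S = 0 ↔ ∀ i, x i ∉ S := by
  rw [sum_dirac_apply]
  simp [Set.eq_empty_iff_forall_notMem]

theorem sum_dirac_eq_one_iff {ι E : Type*} [Countable ι] [MeasurableSpace E]
    [MeasurableSingletonClass E] (x : ι → E) (S : Set E) :
    (Measure.sum fun i => Measure.dirac (x i)) S = 1 ↔ ∃ i, {i | x i ∈ S} = {i} := by
  rw [sum_dirac_apply, ← Set.encard_eq_one]
  norm_cast

theorem orderPath_pointMeasure_mem_entourage {Ω ι : Type*} [Countable ι]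
    {N : Ω → Measure (PolarSpace T × ℝ≥0)} {ω : Ω} {x : ι → PolarSpace T × ℝ≥0}
    (hN : N ω = Measure.sum fun i => Measure.dirac (x i))
    (hx : LocallyFinitelyLarge (fun i => (x i).1.toCPlus) (fun i => (x i).2))
    {m L : ℕ} {h ε a : ℝ≥0} (hh : 0 < h) (ha : a ≤ m * h)
    {S : Set (PolarSpace T)} (hS : ∀ p ∉ S, ∀ t, p.toCPlus t ≤ ε)
    {A : Fin L → Set (PolarSpace T)} {g : Fin L → CPlus T} (hAS : ∀ l, A l ⊆ S)
    (hA : ∀ l, ∀ p ∈ A l, dist p.toCPlus (g l) ≤ ε) (q : Fin m → Option (Fin L))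
    (hgrid : N ω (S ×ˢ Set.range fun b : ℕ => (b : ℝ≥0) * h) = 0)
    (hω : ∀ b : Fin m, ω ∈ poissonBlockEvent N S (Set.Ioc ((b : ℕ) * h) (((b : ℕ) + 1) * h))
      ((q b).map A)) (r : ℕ) :
    (orderPath _ _ hx r, patternPath (fun b => (q b).map g) h r) ∈
      SkorokhodSpace.entourage (Fin r → CPlus T) a (max ε h) := by
  rw [hN, sum_dirac_eq_zero_iff] at hgrid
  refine orderPath_patternPath_mem_entourage hx hh ha ?_ ?_ ?_ r
  · intro i hi t
    by_contra hlt
    refine hgrid i ⟨by_contra fun h' => hlt (hS _ h' t), 0, ?_⟩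
    simp [hi]
  · intro b hb i hi t
    rw [Option.map_eq_none_iff] at hb
    have := (hω b).2
    rw [hb, Set.mem_ofPred_eq, hN, Nat.cast_zero, sum_dirac_eq_zero_iff] at this
    refine hS _ (fun h' => this i ⟨⟨h', ?_⟩, hi⟩) t
    exact Set.notMem_empty _
  · intro b g' hb
    obtain ⟨l, hl, rfl⟩ := Option.map_eq_some_iff.1 hb
    obtain ⟨h1, h2⟩ := hω b
    rw [hl, Set.mem_ofPred_eq, hN] at h1 h2
    simp only [Option.map_some, Option.isSome_some, if_true, Nat.cast_one, Option.getD_some,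
      Nat.cast_zero] at h1 h2
    rw [sum_dirac_eq_one_iff] at h1
    rw [sum_dirac_eq_zero_iff] at h2
    obtain ⟨i, hi⟩ := h1
    have hi' : x i ∈ A l ×ˢ Set.Ioc ((b : ℕ) * h) (((b : ℕ) + 1) * h) := by
      have : i ∈ {i | x i ∈ A l ×ˢ Set.Ioc ((b : ℕ) * h) (((b : ℕ) + 1) * h)} := by
        rw [hi]
        rfl
      exact this
    refine ⟨i, ⟨hi'.2.1, lt_of_le_of_ne hi'.2.2 fun he => ?_⟩, hA l _ hi'.1, fun i' hi'' hne t => ?_⟩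
    · refine hgrid i ⟨hAS l hi'.1, (b : ℕ) + 1, ?_⟩
      dsimp only
      rw [he]
      push_cast
      rfl
    · refine hS _ (fun h' => ?_) t
      refine h2 i' ⟨⟨h', fun hA' => hne ?_⟩, hi''⟩
      have : i' ∈ {i | x i ∈ A l ×ˢ Set.Ioc ((b : ℕ) * h) (((b : ℕ) + 1) * h)} := ⟨hA', hi''⟩
      rw [hi] at this
      exact this

/-- A cell with at most one point of `S`, and none outside the `A l`, is described by some pattern
entry. -/
theorem exists_mem_poissonBlockEvent {Ω ι : Type*} [Countable ι]
    {N : Ω → Measure (PolarSpace T × ℝ≥0)} {ω : Ω} {x : ι → PolarSpace T × ℝ≥0}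
    (hN : N ω = Measure.sum fun i => Measure.dirac (x i)) {L : ℕ} {J : Set ℝ≥0}
    {S : Set (PolarSpace T)} {A : Fin L → Set (PolarSpace T)} (hAS : ∀ l, A l ⊆ S)
    (h1 : N ω (S ×ˢ J) = 0 ∨ N ω (S ×ˢ J) = 1) (h2 : N ω ((S \ ⋃ l, A l) ×ˢ J) = 0) :
    ∃ o : Option (Fin L), ω ∈ poissonBlockEvent N S J (o.map A) := by
  rcases h1 with h1 | h1
  · refine ⟨none, ?_, ?_⟩
    · simp
    · simpa using h1
  · rw [hN, sum_dirac_eq_one_iff] at h1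
    rw [hN, sum_dirac_eq_zero_iff] at h2
    obtain ⟨i, hi⟩ := h1
    have hi' : x i ∈ S ×ˢ J := by
      have : i ∈ {i | x i ∈ S ×ˢ J} := by
        rw [hi]
        rfl
      exact this
    have hmem : (x i).1 ∈ ⋃ l, A l := by
      by_contra hc
      exact h2 i ⟨⟨hi'.1, hc⟩, hi'.2⟩
    obtain ⟨l, hl⟩ := Set.mem_iUnion.1 hmem
    have huniq : ∀ i', x i' ∈ S ×ˢ J → i' = i := by
      intro i' h'
      have : i' ∈ {i | x i ∈ S ×ˢ J} := h'
      rw [hi] at this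
      exact this
    refine ⟨some l, ?_, ?_⟩
    · rw [Set.mem_ofPred_eq, hN]
      simp only [Option.map_some, Option.isSome_some, if_true, Nat.cast_one, Option.getD_some]
      rw [sum_dirac_eq_one_iff]
      refine ⟨i, Set.Subset.antisymm (fun i' h' => huniq i' ⟨hAS l h'.1, h'.2⟩) ?_⟩
      rintro _ rfl
      exact ⟨hl, hi'.2⟩
    · rw [Set.mem_ofPred_eq, hN]
      simp only [Option.map_some, Nat.cast_zero, Option.getD_some]
      rw [sum_dirac_eq_zero_iff]
      rintro i' ⟨⟨h', h''⟩, h'''⟩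
      rw [huniq i' ⟨h', h'''⟩] at h''
      exact h'' hl

end PoissonPath


/-! ### Convergence of the order statistics -/

theorem HasFiniteApproximation.of_fintype {D : Type*} {Ω : ℕ → Type*} [∀ n, MeasurableSpace (Ω n)]
    {P : (n : ℕ) → Measure (Ω n)} {Y : (n : ℕ) → Ω n → D}
    {Ω' : Type*} [MeasurableSpace Ω'] {P' : Measure Ω'} {Y' : Ω' → D}
    {V : Set (D × D)} {η : ℝ} {κ : Type*} [Fintype κ] (y : κ → D) (A : (n : ℕ) → κ → Set (Ω n))
    (A' : κ → Set Ω') (hA : ∀ n k, MeasurableSet (A n k)) (hA' : ∀ k, MeasurableSet (A' k))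
    (hd : ∀ n, Pairwise (Function.onFun Disjoint (A n)))
    (hd' : Pairwise (Function.onFun Disjoint A'))
    (hV : ∀ᶠ n in atTop, ∀ k, ∀ᵐ ω ∂P n, ω ∈ A n k → (Y n ω, y k) ∈ V)
    (hV' : ∀ k, ∀ᵐ ω ∂P', ω ∈ A' k → (Y' ω, y k) ∈ V)
    (hlim : ∀ k, Tendsto (fun n => (P n).real (A n k)) atTop (𝓝 (P'.real (A' k))))
    (hbad : P'.real (⋃ k, A' k)ᶜ ≤ η) : HasFiniteApproximation P Y P' Y' V η := by
  let e := (Fintype.equivFin κ).symm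
  refine ⟨Fintype.card κ, fun k => y (e k), fun n k => A n (e k), fun k => A' (e k),
    fun n k => hA n _, fun k => hA' _, fun n => (hd n).comp_of_injective e.injective,
    hd'.comp_of_injective e.injective, ?_, fun k => hV' _, fun k => hlim _, ?_⟩
  · filter_upwards [hV] with n hn k using hn _
  · rwa [e.surjective.iUnion_comp A']

/-- Continuity from above: what finitely many cells leave uncovered decreases to a null set. -/
theorem exists_finite_cells {F : Type*} [MeasurableSpace F] {ν : Measure F} {S : Set F}
    (hS : MeasurableSet S) (hνS : ν S ≠ ∞) {A : ℕ → Set F} (hA : ∀ l, MeasurableSet (A l))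
    (h0 : ν (S \ ⋃ l, A l) = 0) {δ : ℝ} (hδ : 0 < δ) :
    ∃ L : ℕ, ν.real (S \ ⋃ l : Fin L, A l) ≤ δ := by
  have hlim := tendsto_measure_iInter_atTop (μ := ν) (s := fun L : ℕ => S \ ⋃ l : Fin L, A l)
    (fun L => (hS.diff (MeasurableSet.iUnion fun l => hA _)).nullMeasurableSet)
    (fun L L' hL => Set.sdiff_subset_sdiff_right (Set.iUnion_subset fun l =>
      Set.subset_iUnion_of_subset ⟨l, l.2.trans_le hL⟩ subset_rfl))
    ⟨0, measure_ne_top_of_subset Set.sdiff_subset hνS⟩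
  have e : (⋂ L : ℕ, S \ ⋃ l : Fin L, A l) = S \ ⋃ l, A l := by
    ext p
    simp only [Set.mem_iInter, Set.mem_sdiff, Set.mem_iUnion, not_exists]
    constructor
    · intro h
      exact ⟨(h 0).1, fun l => (h (l + 1)).2 ⟨l, Nat.lt_succ_self l⟩⟩
    · rintro ⟨h1, h2⟩ L
      exact ⟨h1, fun l => h2 l⟩
  rw [e, h0] at hlim
  obtain ⟨L, hL⟩ := (hlim.eventually_lt_const (ENNReal.ofReal_pos.2 hδ)).exists
  exact ⟨L, ENNReal.toReal_le_of_le_ofReal hδ.le hL.le⟩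

theorem measureReal_iInter_fin_blockEvent {Ω α : Type*} [MeasurableSpace Ω] [MeasurableSpace α]
    {P : Measure Ω} [IsProbabilityMeasure P] {X : ℕ → Ω → α}
    (hX : ∀ i, Measurable (X i)) (hind : iIndepFun X P) {S : Set α} (hS : MeasurableSet S)
    {k : ℕ → ℕ} (hk : Monotone k) {m : ℕ} (o : Fin m → Option (Set α))
    (ho : ∀ b, ∀ C ∈ o b, MeasurableSet C) :
    P.real (⋂ b : Fin m, blockEvent X S (Finset.Ico (k b) (k (b + 1))) (o b)) =
      ∏ b : Fin m, P.real (blockEvent X S (Finset.Ico (k b) (k (b + 1))) (o b)) := by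
  let o' : ℕ → Option (Set α) := fun b => if hb : b < m then o ⟨b, hb⟩ else none
  have ho' : ∀ b : Fin m, o' b = o b := fun b => dif_pos b.2
  have h := measureReal_iInter_blockEvent hX hind hS hk o' (fun b C hC => by
    by_cases hb : b < m
    · exact ho ⟨b, hb⟩ C (by simpa [o', hb] using hC)
    · simp [o', hb] at hC) m
  rw [Finset.prod_range] at h
  simp_rw [ho'] at h
  rw [← h]
  congr 1
  ext ω
  simp only [Set.mem_iInter, Finset.mem_range]
  constructor
  · intro h b hb
    have := h ⟨b, hb⟩
    rwa [← ho'] at this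
  · intro h b
    rw [← ho']
    exact h b b.2

section Main

variable {T : Type*} [MetricSpace T] [CompactSpace T]
  {Ω : ℕ → Type*} [∀ n, MeasurableSpace (Ω n)] {P : (n : ℕ) → Measure (Ω n)}
  [∀ n, IsProbabilityMeasure (P n)] {X : (n : ℕ) → ℕ → Ω n → CPlus T} {ν : Measure (PolarSpace T)}

theorem tendsto_mul_measureReal_polarPreimage (hX_meas : ∀ n i, Measurable (X n i))
    (hν : IsBoundedlyFinite ν)
    (hX_lim : TendstoSharpWeakly
      (fun n => (n : ℝ≥0∞) • polarMeasure ((P n).map (X n 0))) ν)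
    {S : Set (PolarSpace T)} (hSb : Bornology.IsBounded S) (hS : MeasurableSet S)
    (hfr : ν (frontier S) = 0) :
    Tendsto (fun n : ℕ => n * (P n).real (X n 0 ⁻¹' polarPreimage S)) atTop (𝓝 (ν.real S)) := by
  have hprob : ∀ n, IsProbabilityMeasure ((P n).map (X n 0)) := fun n =>
    Measure.isProbabilityMeasure_map (hX_meas n 0).aemeasurable
  have hfin : ∀ n : ℕ, IsFiniteMeasure ((n : ℝ≥0∞) • polarMeasure ((P n).map (X n 0))) := fun n =>
    Measure.smul_finite _ (ENNReal.natCast_ne_top n)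
  refine (hX_lim.tendsto_measureReal hν hSb hS hfr).congr fun n => ?_
  rw [measureReal_ennreal_smul_apply, ENNReal.toReal_natCast, measureReal_def,
    polarMeasure_apply _ hS, Measure.map_apply (hX_meas n 0) (measurableSet_polarPreimage hS)]
  rfl

theorem tendsto_measureReal_blockEvent (hX_meas : ∀ n i, Measurable (X n i))
    (hX_indep : ∀ n, iIndepFun (X n) (P n))
    (hX_ident : ∀ n i, IdentDistrib (X n i) (X n 0) (P n) (P n))
    (hν : IsBoundedlyFinite ν)
    (hX_lim : TendstoSharpWeakly
      (fun n => (n : ℝ≥0∞) • polarMeasure ((P n).map (X n 0))) ν)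
    {S : Set (PolarSpace T)} (hSb : Bornology.IsBounded S) (hS : MeasurableSet S)
    (hfr : ν (frontier S) = 0) (o : Option (Set (PolarSpace T)))
    (ho : ∀ C ∈ o, MeasurableSet C ∧ C ⊆ S ∧ ν (frontier C) = 0) (h : ℝ≥0) (b : ℕ) :
    Tendsto (fun n : ℕ => (P n).real (blockEvent (X n) (polarPreimage S)
      (Finset.Ico ⌊(n : ℝ≥0) * (b * h)⌋₊ ⌊(n : ℝ≥0) * (((b + 1 : ℕ) : ℝ≥0) * h)⌋₊)
      (o.map polarPreimage))) atTop (𝓝 (blockLimit ν S h o)) := by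
  have hSlim := tendsto_mul_measureReal_polarPreimage hX_meas hν hX_lim hSb hS hfr
  have hform := fun n J => measureReal_blockEvent (hX_meas n) (hX_indep n) (hX_ident n)
    (measurableSet_polarPreimage hS) J (o.map polarPreimage) (by
      intro C hC
      obtain ⟨C', hC', rfl⟩ := Option.map_eq_some_iff.1 hC
      exact ⟨measurableSet_polarPreimage (ho C' hC').1, polarPreimage_mono (ho C' hC').2.1⟩)
  simp_rw [hform]
  rcases o with _ | C
  · exact tendsto_one_sub_pow (fun n => measureReal_le_one) hSlim (tendsto_card_block h b)
  · obtain ⟨hC, hCS, hCfr⟩ := ho C rfl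
    exact tendsto_mul_one_sub_pow (fun n => measureReal_le_one) hSlim
      (tendsto_mul_measureReal_polarPreimage hX_meas hν hX_lim (hSb.subset hCS) hC hCfr)
      (tendsto_card_block h b)

theorem exists_grid {a lam ε η : ℝ} (ha : 0 ≤ a) (hε : 0 < ε) (hη : 0 < η) :
    ∃ (h : ℝ≥0) (m : ℕ), 0 < h ∧ Irrational h ∧ (h : ℝ) ≤ ε ∧ a ≤ m * h ∧ m * (h : ℝ) ≤ a + 1 ∧
      m * (lam * h) ^ 2 ≤ η := by
  -- With `m h ≤ a + 1`, for which `h ≤ 1` is used, one has `m (lam h)² = (m h)(h lam²) ≤ (a + 1) h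
  -- lam²`; the last bound on `h` makes this at most `η`.
  have hκ : 0 < min (min ε 1) (η / ((a + 1) * (lam ^ 2 + 1))) := by positivity
  obtain ⟨h, hirr, h0, hlt⟩ := exists_irrational_btwn hκ
  have h1 : h < ε := hlt.trans_le ((min_le_left _ _).trans (min_le_left _ _))
  have h2 : h < 1 := hlt.trans_le ((min_le_left _ _).trans (min_le_right _ _))
  have h3 : h < η / ((a + 1) * (lam ^ 2 + 1)) := hlt.trans_le (min_le_right _ _)
  have hm1 : a ≤ (⌈a / h⌉₊ : ℝ) * h := by
    rw [← div_le_iff₀ h0]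
    exact Nat.le_ceil _
  have hm2 : (⌈a / h⌉₊ : ℝ) * h ≤ a + 1 := by
    have := Nat.ceil_lt_add_one (div_nonneg ha h0.le)
    have h4 : (⌈a / h⌉₊ : ℝ) * h ≤ (a / h + 1) * h := by gcongr
    rw [add_mul, div_mul_cancel₀ _ h0.ne', one_mul] at h4
    linarith
  refine ⟨⟨h, h0.le⟩, ⌈a / h⌉₊, h0, hirr, h1.le, hm1, hm2, ?_⟩
  change (⌈a / h⌉₊ : ℝ) * (lam * h) ^ 2 ≤ η
  rw [lt_div_iff₀ (by positivity)] at h3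
  have h5 : (⌈a / h⌉₊ : ℝ) * (lam * h) ^ 2 ≤ (a + 1) * (h * lam ^ 2) := by
    have : (⌈a / h⌉₊ : ℝ) * (lam * h) ^ 2 = ((⌈a / h⌉₊ : ℝ) * h) * (h * lam ^ 2) := by ring
    rw [this]
    gcongr
  nlinarith

/-- If no pattern occurs, some time cell has at least two points of `S` or a point not covered by
the `A l`. A union bound over the `m` cells gives the two terms. -/
theorem measureReal_compl_iUnion_poissonBlockEvent_le {Ω' : Type*} [MeasurableSpace Ω']
    {P' : Measure Ω'} [IsProbabilityMeasure P'] {N : Ω' → Measure (PolarSpace T × ℝ≥0)}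
    (hN : IsPoissonPointProcess N (ν.prod lebesgueHalfLine) P') {S : Set (PolarSpace T)}
    (hS : MeasurableSet S) (hνS : ν S ≠ ∞) {L : ℕ} {A : Fin L → Set (PolarSpace T)}
    (hA : ∀ l, MeasurableSet (A l)) (hAS : ∀ l, A l ⊆ S) (h : ℝ≥0) (m : ℕ) :
    P'.real (⋃ q : Fin m → Option (Fin L), ⋂ b : Fin m,
      poissonBlockEvent N S (Set.Ioc ((b : ℕ) * h) (((b : ℕ) + 1) * h)) ((q b).map A))ᶜ ≤
      m * (ν.real S * h) ^ 2 + m * h * ν.real (S \ ⋃ l, A l) := by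
  set J : Fin m → Set ℝ≥0 := fun b => Set.Ioc ((b : ℕ) * h) (((b : ℕ) + 1) * h) with hJ
  set S' := S \ ⋃ l, A l with hS'
  have hS'm : MeasurableSet S' := hS.diff (MeasurableSet.iUnion hA)
  have hJm : ∀ b, MeasurableSet (J b) := fun b => measurableSet_Ioc
  have hprod : ∀ (b : Fin m) (D : Set (PolarSpace T)),
      (ν.prod lebesgueHalfLine) (D ×ˢ J b) = ν D * h := by
    intro b D
    rw [Measure.prod_prod, lebesgueHalfLine_Ioc_grid]
  have hreal : ∀ (b : Fin m) (D : Set (PolarSpace T)),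
      (ν.prod lebesgueHalfLine).real (D ×ˢ J b) = ν.real D * h := by
    intro b D
    rw [measureReal_def, hprod, ENNReal.toReal_mul]
    rfl
  have hsub : (⋃ q : Fin m → Option (Fin L), ⋂ b : Fin m,
      poissonBlockEvent N S (J b) ((q b).map A))ᶜ ⊆
      ⋃ b ∈ (Finset.univ : Finset (Fin m)), ({ω | N ω (S ×ˢ J b) ≠ 0 ∧ N ω (S ×ˢ J b) ≠ 1} ∪
        {ω | N ω (S' ×ˢ J b) ≠ 0}) := by
    intro ω hω
    by_contra hc
    simp only [Finset.mem_univ, Set.iUnion_true, Set.mem_iUnion, not_exists, Set.mem_union,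
      Set.mem_ofPred_eq, not_or, not_and_or, not_not] at hc
    obtain ⟨I, x, hx, hNx⟩ := hN.pointMeasure ω
    choose q hq using fun b => exists_mem_poissonBlockEvent hNx hAS (hc b).1 (hc b).2
    exact hω (Set.mem_iUnion.2 ⟨q, Set.mem_iInter.2 hq⟩)
  refine (measureReal_mono hsub (measure_ne_top _ _)).trans ((measureReal_biUnion_finset_le _ _).trans ?_)
  have hb : ∀ b ∈ (Finset.univ : Finset (Fin m)),
      P'.real ({ω | N ω (S ×ˢ J b) ≠ 0 ∧ N ω (S ×ˢ J b) ≠ 1} ∪ {ω | N ω (S' ×ˢ J b) ≠ 0}) ≤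
        (ν.real S * h) ^ 2 + h * ν.real S' := by
    intro b _
    refine (measureReal_union_le _ _).trans (add_le_add ?_ ?_)
    · rw [← hreal b]
      refine hN.measureReal_ne_zero_one_le (hS.prod (hJm b)) ?_
      rw [hprod]
      exact ENNReal.mul_ne_top hνS ENNReal.coe_ne_top
    · rw [mul_comm, ← hreal b]
      refine hN.measureReal_ne_zero_le (hS'm.prod (hJm b)) ?_
      rw [hprod]
      exact ENNReal.mul_ne_top (measure_ne_top_of_subset Set.sdiff_subset hνS) ENNReal.coe_ne_top
  refine (Finset.sum_le_sum hb).trans (le_of_eq ?_)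
  rw [Finset.sum_const, Finset.card_univ, Fintype.card_fin, nsmul_eq_mul]
  ring

theorem pairwise_disjoint_iInter {κ Ω' : Type*} {m : ℕ}
    {B : Fin m → Option κ → Set Ω'} (hB : ∀ b o o', o ≠ o' → Disjoint (B b o) (B b o')) :
    Pairwise (Function.onFun Disjoint fun q : Fin m → Option κ => ⋂ b, B b (q b)) := by
  intro q q' hne
  obtain ⟨b, hb⟩ := Function.ne_iff.1 hne
  exact (hB b _ _ hb).mono (Set.iInter_subset _ b) (Set.iInter_subset _ b)

theorem isSome_or_isSome_of_ne {κ : Type*} {o o' : Option κ} (h : o ≠ o') :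
    o.isSome ∨ o'.isSome := by
  rcases o with _ | l <;> rcases o' with _ | l' <;> simp_all

theorem disjoint_of_mem_map {κ α : Type*} {B : κ → Set α}
    (hB : Pairwise (Function.onFun Disjoint B)) {o o' : Option κ} (h : o ≠ o') :
    ∀ C ∈ o.map B, ∀ C' ∈ o'.map B, Disjoint C C' := by
  intro C hC C' hC'
  obtain ⟨l, rfl, rfl⟩ := Option.map_eq_some_iff.1 hC
  obtain ⟨l', rfl, rfl⟩ := Option.map_eq_some_iff.1 hC'
  exact hB fun h' => h (congrArg some h')

theorem hasFiniteApproximation_orderStatistics (hX_meas : ∀ n i, Measurable (X n i))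
    (hX_indep : ∀ n, iIndepFun (X n) (P n))
    (hX_ident : ∀ n i, IdentDistrib (X n i) (X n 0) (P n) (P n))
    (hν : IsBoundedlyFinite ν)
    (hX_lim : TendstoSharpWeakly
      (fun n => (n : ℝ≥0∞) • polarMeasure ((P n).map (X n 0))) ν)
    (hν_top : ν {p | p.radius = ∞} = 0) (r : ℕ)
    {Ω' : Type*} [MeasurableSpace Ω'] {P' : Measure Ω'} [IsProbabilityMeasure P']
    {N : Ω' → Measure (PolarSpace T × ℝ≥0)}
    (hN : IsPoissonPointProcess N (ν.prod lebesgueHalfLine) P')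
    (I : Ω' → Set ℕ) (x : (ω : Ω') → I ω → PolarSpace T × ℝ≥0)
    (hx : ∀ ω, LocallyFinitelyLarge (fun i => (x ω i).1.toCPlus) (fun i => (x ω i).2))
    (hNx : ∀ ω, N ω = Measure.sum fun i => Measure.dirac (x ω i))
    {V : Set (SkorokhodSpace (Fin r → CPlus T) × SkorokhodSpace (Fin r → CPlus T))}
    (hV : V ∈ uniformity (SkorokhodSpace (Fin r → CPlus T))) {η : ℝ} (hη : 0 < η) :
    HasFiniteApproximation P (fun n ω => arrayPath n r fun i => X n i ω) P'
      (fun ω => orderPath _ _ (hx ω) r) V η := by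
  have := hν.sigmaFinite
  obtain ⟨⟨a, ε⟩, hε, hVsub⟩ := (SkorokhodSpace.hasBasis_uniformity _).mem_iff.1 hV
  dsimp only at hε hVsub
  obtain ⟨S, hSb, hS, hSfr, hSε⟩ := exists_exceedance_region ν hε
  have hνS : ν S ≠ ∞ := (hν S hSb hS).ne
  obtain ⟨h, m, hh, hirr, hhε, ham, hma, hmh⟩ := exists_grid (lam := ν.real S) (NNReal.coe_nonneg a)
    (NNReal.coe_pos.2 hε) (half_pos hη)
  obtain ⟨A₀, g₀, hA₀, hA₀d, hA₀g, hA₀U⟩ := exists_cells ν (NNReal.coe_pos.2 hε)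
  -- The uncovered mass is multiplied by `m h ≤ a + 1`, so it contributes at most `η/2`; the other
  -- half pays for double points. The cells miss only infinite radius, which is `ν`-null.
  obtain ⟨L, hL⟩ := exists_finite_cells hS hνS (fun l => (hA₀ l).1) (δ := η / (2 * (a + 1)))
    (measure_mono_null (fun p hp => by
      have := hp.2
      rw [hA₀U] at this
      simpa using this) hν_top) (by positivity)
  let A : Fin L → Set (PolarSpace T) := fun l => A₀ l ∩ S
  let g : Fin L → CPlus T := fun l => g₀ l
  have hA : ∀ l, MeasurableSet (A l) := fun l => (hA₀ l).1.inter hS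
  have hAS : ∀ l, A l ⊆ S := fun l => Set.inter_subset_right
  have hAfr : ∀ l, ν (frontier (A l)) = 0 := fun l => null_frontier_inter (hA₀ l).2 hSfr
  have hAd : Pairwise (Function.onFun Disjoint A) := fun l l' hne =>
    (hA₀d fun h' => hne (Fin.ext h')).mono Set.inter_subset_left Set.inter_subset_left
  have hAg : ∀ l, ∀ p ∈ A l, dist p.toCPlus (g l) ≤ ε := fun l p hp => hA₀g l p hp.1
  have hAS' : S \ ⋃ l, A l = S \ ⋃ l : Fin L, A₀ l := by
    rw [← Set.iUnion_inter, Set.inter_comm, Set.sdiff_self_inter]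
  have hmap : ∀ (o : Option (Fin L)), ∀ C ∈ o.map A, MeasurableSet C ∧ C ⊆ S ∧
      ν (frontier C) = 0 := by
    intro o C hC
    obtain ⟨l, -, rfl⟩ := Option.map_eq_some_iff.1 hC
    exact ⟨hA l, hAS l, hAfr l⟩
  have hmap' : ∀ (o : Option (Fin L)), ∀ C ∈ o.map (fun l => polarPreimage (A l)),
      MeasurableSet C ∧ C ⊆ polarPreimage S := by
    intro o C hC
    obtain ⟨l, -, rfl⟩ := Option.map_eq_some_iff.1 hC
    exact ⟨measurableSet_polarPreimage (hA l), polarPreimage_mono (hAS l)⟩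
  have ha : a ≤ m * h := by exact_mod_cast ham
  have hmax : max ε h = ε := max_eq_left (by exact_mod_cast hhε)
  let k : ℕ → ℕ → ℕ := fun n b => ⌊(n : ℝ≥0) * ((b : ℝ≥0) * h)⌋₊
  have hk : ∀ n, Monotone (k n) := fun n b b' hb => by
    refine Nat.floor_mono ?_
    gcongr
  let J : Fin m → Set ℝ≥0 := fun b => Set.Ioc ((b : ℕ) * h) (((b : ℕ) + 1) * h)
  refine HasFiniteApproximation.of_fintype (κ := Fin m → Option (Fin L))
    (fun q => patternPath (fun b => (q b).map g) h r)
    (fun n q => ⋂ b : Fin m, blockEvent (X n) (polarPreimage S)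
      (Finset.Ico (k n b) (k n ((b : ℕ) + 1))) ((q b).map fun l => polarPreimage (A l)))
    (fun q => ⋂ b : Fin m, poissonBlockEvent N S (J b) ((q b).map A)) ?_ ?_ ?_ ?_ ?_ ?_ ?_ ?_
  · exact fun n q => MeasurableSet.iInter fun b => measurableSet_blockEvent (hX_meas n)
      (measurableSet_polarPreimage hS) (fun C hC => (hmap' _ C hC).1) _
  · exact fun q => MeasurableSet.iInter fun b => hN.measurableSet_poissonBlockEvent hS
      measurableSet_Ioc (fun C hC => (hmap _ C hC).1)
  · intro n
    refine pairwise_disjoint_iInter (B := fun (b : Fin m) o => blockEvent (X n) (polarPreimage S)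
      (Finset.Ico (k n b) (k n ((b : ℕ) + 1))) (o.map fun l => polarPreimage (A l)))
      fun b o o' hoo => ?_
    refine disjoint_blockEvent (fun C hC => (hmap' _ C hC).2) (fun C hC => (hmap' _ C hC).2)
      (disjoint_of_mem_map (fun l l' hne => disjoint_polarPreimage (hAd hne)) hoo) ?_
    simpa using isSome_or_isSome_of_ne hoo
  · refine pairwise_disjoint_iInter (B := fun (b : Fin m) o => poissonBlockEvent N S (J b)
      (o.map A)) fun b o o' hoo => ?_
    refine disjoint_poissonBlockEvent (fun C hC => (hmap _ C hC).2.1)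
      (fun C hC => (hmap _ C hC).2.1) (disjoint_of_mem_map hAd hoo) ?_
    simpa using isSome_or_isSome_of_ne hoo
  · filter_upwards [eventually_ne_atTop 0] with n hn q
    refine ae_of_all _ fun ω hω => hVsub ?_
    rw [← hmax]
    exact arrayPath_patternPath_mem_entourage hn hh hirr ha hSε hAg q
      (fun b => Set.mem_iInter.1 hω b) r
  · intro q
    -- The Poisson counterpart of the irrationality of `h`: almost surely no point of `S` sits at a
    -- grid time, including time `0`.
    have hgrid : (ν.prod lebesgueHalfLine) (S ×ˢ Set.range fun b : ℕ => (b : ℝ≥0) * h) = 0 := by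
      rw [Measure.prod_prod, lebesgueHalfLine_countable (Set.countable_range _), mul_zero]
    filter_upwards [hN.ae_eq_zero (hS.prod (Set.countable_range _).measurableSet) hgrid]
      with ω hω0 hω
    refine hVsub ?_
    rw [← hmax]
    exact orderPath_pointMeasure_mem_entourage (hNx ω) (hx ω) hh ha hSε hAS hAg q hω0
      (fun b => Set.mem_iInter.1 hω b) r
  · intro q
    rw [hN.measureReal_iInter_poissonBlockEvent hS hνS h (fun b => (q b).map A)
      (fun b C hC => ⟨(hmap _ C hC).1, (hmap _ C hC).2.1⟩)]
    have e : ∀ n, (P n).real (⋂ b : Fin m, blockEvent (X n) (polarPreimage S)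
        (Finset.Ico (k n b) (k n ((b : ℕ) + 1))) ((q b).map fun l => polarPreimage (A l))) =
        ∏ b : Fin m, (P n).real (blockEvent (X n) (polarPreimage S)
          (Finset.Ico (k n b) (k n ((b : ℕ) + 1))) ((q b).map fun l => polarPreimage (A l))) :=
      fun n => measureReal_iInter_fin_blockEvent (hX_meas n) (hX_indep n)
        (measurableSet_polarPreimage hS) (hk n) _ (fun b C hC => (hmap' _ C hC).1)
    simp_rw [e]
    refine tendsto_finsetProd _ fun b _ => ?_
    have := tendsto_measureReal_blockEvent hX_meas hX_indep hX_ident hν hX_lim hSb hS hSfr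
      ((q b).map A) (hmap _) h b
    simp_rw [Option.map_map] at this
    exact this
  · refine (measureReal_compl_iUnion_poissonBlockEvent_le hN hS hνS hA hAS h m).trans ?_
    rw [hAS']
    have h1 : m * h * ν.real (S \ ⋃ l : Fin L, A₀ l) ≤ (a + 1) * (η / (2 * (a + 1))) := by
      gcongr
    have h2 : ((a : ℝ) + 1) * (η / (2 * (a + 1))) = η / 2 := by
      field_simp
    linarith

end Main

end

/-- Row `n` of the array lives on its own probability space `(Ω n, P n)`, and `X n i` stands for
the `(i+1)`-th process of that row, so that the first `[nu]` processes of row `n` are `X n i` with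
`i < [nu]`. -/
theorem theorem3 {T : Type*} [MetricSpace T] [CompactSpace T]
    {Ω : ℕ → Type*} [∀ n, MeasurableSpace (Ω n)]
    (P : (n : ℕ) → Measure (Ω n)) [∀ n, IsProbabilityMeasure (P n)]
    (X : (n : ℕ) → ℕ → Ω n → CPlus T)
    (hX_meas : ∀ n i, Measurable (X n i))
    (hX_indep : ∀ n, iIndepFun (X n) (P n))
    (hX_ident : ∀ n i, IdentDistrib (X n i) (X n 0) (P n) (P n))
    (ν : Measure (PolarSpace T)) (hν : IsBoundedlyFinite ν)
    (hX_lim : TendstoSharpWeakly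
      (fun n => (n : ℝ≥0∞) • polarMeasure ((P n).map (X n 0))) ν)
    (hν_top : ν {p | p.radius = ∞} = 0)
    (r : ℕ) (hr : 1 ≤ r)
    {Ω' : Type*} [MeasurableSpace Ω'] (P' : Measure Ω') [IsProbabilityMeasure P']
    (N : Ω' → Measure (PolarSpace T × ℝ≥0))
    (hN : IsPoissonPointProcess N (ν.prod lebesgueHalfLine) P') :
    ∃ (M : (n : ℕ) → Ω n → SkorokhodSpace (Fin r → CPlus T))
      (M' : Ω' → SkorokhodSpace (Fin r → CPlus T)),
      (∀ n ω u (j : Fin r) t, M n ω u j t =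
        nthLargest ((Multiset.range ⌊(n : ℝ≥0) * u⌋₊).map fun i => X n i ω t) j) ∧
      (∀ ω u (j : Fin r) t, M' ω u j t = spaceTimeOrderStat (N ω) j u t) ∧
      TendstoInDistribution M atTop M' P P' := by
  -- The atoms are enumerated for each `ω` separately, without measurability in `ω`; the order
  -- statistics depend only on the measure `N ω`, and measurability of the path comes from the
  -- approximation.
  choose I x hxfin hNx using hN.pointMeasure
  have hx : ∀ ω, LocallyFinitelyLarge (fun i => (x ω i).1.toCPlus) (fun i => (x ω i).2) := fun ω =>
    locallyFinitelyLarge_of_finite_preimage (hxfin ω)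
  refine ⟨fun n ω => arrayPath n r fun i => X n i ω, fun ω => orderPath _ _ (hx ω) r,
    fun n ω u j t => arrayPath_apply n r _ u j t, fun ω u j t => ?_, ?_⟩
  · rw [orderPath_apply, hNx ω, spaceTimeOrderStat_sum_dirac]
  · refine tendstoInDistribution_of_hasFiniteApproximation (fun n => ?_) fun V hV η hη =>
      hasFiniteApproximation_orderStatistics hX_meas hX_indep hX_ident hν hX_lim hν_top r hN I x hx
        hNx hV hη
    exact ((measurable_arrayPath n r).comp (measurable_pi_lambda _ (hX_meas n))).aemeasurable
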